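/- Fix $d\in\mathbf N$, let $\langle\cdot,\cdot\rangle$ be the scalar product on $\mathbf R^d$, $s>1$, $q\in[1,\infty]$. For a smooth $\varphi:\mathbf R^d\to\mathbf C$, a compact $K$ and $A>0$ put $\|\varphi\|_{s,A,K}=\sup_{\beta\in\mathbf N^d}\sup_{x\in K}\frac{A^{|\beta|}}{(\beta!)^s}|\varphi^{(\beta)}(x)|$. * $\mathcal E^{\{s\}}(\mathbf R^d)$ is the space of all $\varphi\in C^\infty(\mathbf R^d)$ such that for every compact $K$ there is $A>0$ with $\|\varphi\|_{s,A,K}<\infty$, with the topology $\operatorname{proj\,lim}_K\operatorname{ind\,lim}_{A\to0}$ (locally convex inductive limit of the spaces $\{\varphi\in C^\infty(\mathbf R^d):\|\varphi\|_{s,A,K}<\infty\}$ with the seminorms $\|\cdot\|_{s,A,K}$); $(\mathcal E^{\{s\}})'(\mathbf R^d)$ is its dual. For $f\in(\mathcal E^{\{s\}})'(\mathbf R^d)$ set $\widehat f(\xi)=(2\pi)^{-d/2}\langle f,e^{-i\langle\cdot,\xi\rangle}\rangle$. The support of $f$ is the complement of the union of all open $U$ such that $\langle f,\varphi\rangle=0$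 for all $\varphi\in\mathcal E^{\{s\}}(\mathbf R^d)$ with compact support in $U$. * For $X\subseteq\mathbf R^d$ open, $\mathcal D^{(s)}(X)$ is the set of all $\varphi\in C^\infty(\mathbf R^d)$ whose support is contained in some compact $K\subset X$ with $\|\varphi\|_{s,A,K}<\infty$ for every $A>0$. The product $\varphi f$ is given by $\langle\varphi f,\psi\rangle=\langle f,\varphi\psi\rangle$. * $\mathscr M_{\{s\}}(\mathbf R^d)$ is the set of all $\omega:\mathbf R^d\to[0,\infty)$ for which there are a submultiplicative $v:\mathbf R^d\to[0,\infty)$ (that is, $v(x+y)\le v(x)v(y)$) and constants $C,k>0$ with $v(x)\le Ce^{k|x|^{1/s}}$ and $\omega(x+y)\le C\,v(x)\,\omega(y)$ for all $x,y\in\mathbf R^d$. * For $\omega\in\mathscr M_{\{s\}}(\mathbf R^d)$, $\mathcal B=\mathscr FL^q_{(\omega)}(\mathbf R^d)$, $f\in(\mathcal E^{\{s\}})'(\mathbf R^d)$ and $H\subset\mathbf R^d$ discrete, $|f|^{(D)}_{\mathcal B(H)}=\big(\sum_{\xi\in H}|\widehat f(\xi)\omega(\xi)|^q\big)^{1/q}\in[0,\infty]$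 (the supremum over $H$ if $q=\infty$). * The lattice with basis $e_1,\dots,e_d$ (a basis of $\mathbf R^d$) is $\{a_1e_1+\dots+a_de_d:a_j\in\mathbf Z\}$. A pair $(\Lambda_1,\Lambda_2)$ of lattices is admissible if they have bases $e_1,\dots,e_d$ and $\varepsilon_1,\dots,\varepsilon_d$, respectively, such that for some $0<c\le2\pi$, $\langle e_j,\varepsilon_j\rangle=c$ for all $j$ and $\langle e_j,\varepsilon_k\rangle=0$ for $j\ne k$. $\mathcal A(\Lambda)$ is the set of all $\{x_0+t_1e_1+\dots+t_de_d:t_j\in[0,1]\}$ with $x_0\in\Lambda$ and $e_1,\dots,e_d$ a basis for $\Lambda$. * An open cone is an open subset of $\mathbf R^d$ that is invariant under multiplication by positive scalars. **Statement.** Let $\omega\in\mathscr M_{\{s\}}(\mathbf R^d)$, $\mathcal B=\mathscr FL^q_{(\omega)}(\mathbf R^d)$, let $(\Lambda_1,\Lambda_2)$ be an admissible lattice pair, $D_1\in\mathcal A(\Lambda_1)$, and let $f\in(\mathcal E^{\{s\}})'(\mathbf R^d)$ be such that an open neighbourhood of its support is contained in $D_1$. Let $\Gamma$ and $\Gamma_0$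 be open cones such that $\overline{\Gamma_0}\setminus\{0\}\subseteq\Gamma$. If $|f|^{(D)}_{\mathcal B(\Gamma\cap\Lambda_2)}$ is finite, then for every open $X\subseteq\mathbf R^d$ and every $\varphi\in\mathcal D^{(s)}(X)$, $|\varphi f|^{(D)}_{\mathcal B(\Gamma_0\cap\Lambda_2)}$ is finite. -/

import Mathlib

open scoped ENNReal NNReal

namespace Roumieu

/-- `ℝ^d` with its Euclidean norm. -/
abbrev Rd (d : ℕ) : Type := EuclideanSpace ℝ (Fin d)

/-- The iterated derivative of a smooth function is symmetric. -/
theorem iteratedFDeriv_perm {E : Type*} [NormedAddCommGroup E] [NormedSpace ℝ E]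
    {φ : E → ℂ} (hφ : ContDiff ℝ (⊤ : ℕ∞) φ) (n : ℕ) (x : E) (v : Fin n → E) (σ : Equiv.Perm (Fin n)) :
    iteratedFDeriv ℝ n φ x (v ∘ σ) = iteratedFDeriv ℝ n φ x v := by
  have key : ∀ (n : ℕ) (x : E) (v : Fin n → E) (σ : Equiv.Perm (Fin n)),
      iteratedFDeriv ℝ n φ x (v ∘ σ) = iteratedFDeriv ℝ n φ x v := by
    intro n
    induction n with
    | zero => intro x v σ; rw [Subsingleton.elim (v ∘ σ) v]
    | succ n ih =>
      have smooth : ∀ k : ℕ, ContDiff ℝ (⊤ : ℕ∞) (iteratedFDeriv ℝ k φ) := fun k =>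
        hφ.iteratedFDeriv_right (m := (⊤ : ℕ∞)) (by exact_mod_cast le_top)
      have hd : ∀ k : ℕ, Differentiable ℝ (iteratedFDeriv ℝ k φ) := fun k =>
        (smooth k).differentiable (by simp)
      -- permuting all entries but the first
      have tailcase : ∀ (x : E) (v w : Fin (n + 1) → E) (τ : Equiv.Perm (Fin n)), w 0 = v 0 →
          Fin.tail w = Fin.tail v ∘ τ →
          iteratedFDeriv ℝ (n + 1) φ x w = iteratedFDeriv ℝ (n + 1) φ x v := by
        intro x v w τ h0 ht
        rw [iteratedFDeriv_succ_apply_left, iteratedFDeriv_succ_apply_left, h0, ht,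
          ← fderiv_continuousMultilinear_apply_const_apply (hd n x),
          ← fderiv_continuousMultilinear_apply_const_apply (hd n x)]
        have : (fun y => iteratedFDeriv ℝ n φ y (Fin.tail v ∘ τ)) =
            fun y => iteratedFDeriv ℝ n φ y (Fin.tail v) := by
          funext y; exact ih y _ τ
        rw [this]
      have swapcase : ∀ (i : Fin n) (x : E) (v : Fin (n + 1) → E),
          iteratedFDeriv ℝ (n + 1) φ x (v ∘ Equiv.swap i.castSucc i.succ) =
            iteratedFDeriv ℝ (n + 1) φ x v := by
        intro i x v
        cases n with
        | zero => exact i.elim0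
        | succ m =>
          refine Fin.cases ?_ (fun j => ?_) i
          · have two : ∀ w : Fin (m + 2) → E, iteratedFDeriv ℝ (m + 2) φ x w =
                fderiv ℝ (fderiv ℝ (fun y => iteratedFDeriv ℝ m φ y (Fin.tail (Fin.tail w)))) x
                  (w 0) (w 1) := by
              intro w
              have e1 : fderiv ℝ (fun y => iteratedFDeriv ℝ m φ y (Fin.tail (Fin.tail w))) =
                  fun y => (fderiv ℝ (iteratedFDeriv ℝ m φ) y).flipMultilinear
                    (Fin.tail (Fin.tail w)) := by
                funext y
                exact fderiv_continuousMultilinear_apply_const (hd m y) _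
              have hg : ContDiff ℝ (⊤ : ℕ∞) (fun y => iteratedFDeriv ℝ m φ y (Fin.tail (Fin.tail w))) :=
                (ContinuousMultilinearMap.apply ℝ (fun _ : Fin m => E) ℂ _).contDiff.comp (smooth m)
              have e2 : Differentiable ℝ
                  (fderiv ℝ (fun y => iteratedFDeriv ℝ m φ y (Fin.tail (Fin.tail w)))) :=
                (hg.fderiv_right (m := (⊤ : ℕ∞)) (by simp)).differentiable (by simp)
              rw [iteratedFDeriv_succ_apply_left,
                ← fderiv_continuousMultilinear_apply_const_apply (hd (m + 1) x)]
              have e3 : (fun y => iteratedFDeriv ℝ (m + 1) φ y (Fin.tail w)) =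
                  fun y => fderiv ℝ (fun y => iteratedFDeriv ℝ m φ y (Fin.tail (Fin.tail w))) y
                    (w 1) := by
                funext y
                rw [iteratedFDeriv_succ_apply_left, e1]
                rfl
              rw [e3, fderiv_clm_apply (e2 x) (differentiableAt_const _)]
              simp
            rw [two, two]
            have ht : Fin.tail (Fin.tail (v ∘ Equiv.swap (Fin.castSucc (0 : Fin (m + 1)))
                (Fin.succ 0))) = Fin.tail (Fin.tail v) := by
              funext k
              simp only [Fin.tail, Function.comp]
              rw [Equiv.swap_apply_of_ne_of_ne]
              · simp [Fin.ext_iff]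
              · simp [Fin.ext_iff]
            rw [ht]
            have hg : ContDiff ℝ (⊤ : ℕ∞) (fun y => iteratedFDeriv ℝ m φ y (Fin.tail (Fin.tail v))) :=
              (ContinuousMultilinearMap.apply ℝ (fun _ : Fin m => E) ℂ _).contDiff.comp (smooth m)
            have hs : IsSymmSndFDerivAt ℝ
                (fun y => iteratedFDeriv ℝ m φ y (Fin.tail (Fin.tail v))) x :=
              hg.contDiffAt.isSymmSndFDerivAt (by
                rw [minSmoothness_of_isRCLikeNormedField]; exact WithTop.coe_le_coe.2 le_top)
            rw [hs.eq]
            simp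
          · apply tailcase x v _ (Equiv.swap j.castSucc j.succ)
            · simp only [Function.comp]
              rw [Equiv.swap_apply_of_ne_of_ne]
              · simp [Fin.ext_iff]
              · simp [Fin.ext_iff]
            · funext k
              simp only [Fin.tail, Function.comp]
              rw [← Fin.succ_castSucc, ← (Fin.succ_injective _).map_swap]
      intro x v σ
      have hσ : σ ∈ Submonoid.closure
          (Set.range fun i : Fin n => Equiv.swap i.castSucc i.succ) := by
        rw [Equiv.Perm.mclosure_swap_castSucc_succ]; trivial
      induction hσ using Submonoid.closure_induction generalizing v with
      | mem τ hτ => obtain ⟨i, rfl⟩ := hτ; exact swapcase i x v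
      | one => rfl
      | mul a b _ _ ha hb =>
        have : v ∘ (a * b : Equiv.Perm (Fin (n + 1))) = (v ∘ a) ∘ b := rfl
        rw [this, hb, ha]
  exact key n x v σ

/-- The mixed partial derivative `φ^(β) = ∂₁^{β₁} ⋯ ∂_d^{β_d} φ`: the iterated derivative of order
`|β|` in the direction of `β₁` copies of `e₁`, ..., `β_d` copies of `e_d`. -/
noncomputable def multiDeriv {d : ℕ} (β : Fin d → ℕ) (φ : Rd d → ℂ) (x : Rd d) : ℂ :=
  iteratedFDeriv ℝ (∑ i, β i) φ x
    fun j => EuclideanSpace.single (finSigmaFinEquiv.symm j).1 (1 : ℝ)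

/-- `β! = β₁! ⋯ β_d!` -/
def multiFactorial {d : ℕ} (β : Fin d → ℕ) : ℕ := ∏ i, (β i).factorial

/-- `‖φ‖_{s,A,K} = sup_β sup_{x ∈ K} A^{|β|} / (β!)^s |φ^(β)(x)|`, with value in `[0,∞]`. -/
noncomputable def gevreyNorm {d : ℕ} (s A : ℝ) (K : Set (Rd d)) (φ : Rd d → ℂ) : ℝ≥0∞ :=
  ⨆ β : Fin d → ℕ, ⨆ x ∈ K,
    ENNReal.ofReal (A ^ (∑ i, β i) / (multiFactorial β : ℝ) ^ s * ‖multiDeriv β φ x‖)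

theorem multiFactorial_pos {d : ℕ} (β : Fin d → ℕ) : 0 < multiFactorial β :=
  Finset.prod_pos fun _ _ => Nat.factorial_pos _

theorem multiFactorial_le {d : ℕ} (β : Fin d → ℕ) : multiFactorial β ≤ (∑ i, β i).factorial :=
  Nat.le_of_dvd (Nat.factorial_pos _) (Nat.prod_factorial_dvd_factorial_sum _ _)

theorem factorial_sum_le {d : ℕ} (β : Fin d → ℕ) :
    (∑ i, β i).factorial ≤ (2 ^ d) ^ (∑ i, β i) * multiFactorial β := by
  have key : ∀ S : Finset (Fin d),
      (∑ i ∈ S, β i).factorial ≤ (2 ^ S.card) ^ (∑ i ∈ S, β i) * ∏ i ∈ S, (β i).factorial := by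
    intro S
    induction S using Finset.induction_on with
    | empty => simp
    | insert a S ha ih =>
      rw [Finset.sum_insert ha, Finset.prod_insert ha, Finset.card_insert_of_notMem ha]
      set b := ∑ i ∈ S, β i
      have h1 := Nat.add_choose_mul_factorial_mul_factorial (β a) b
      have h2 : (β a + b).choose (β a) ≤ 2 ^ (β a + b) := Nat.choose_le_two_pow _ _
      calc (β a + b).factorial
          = (β a + b).choose (β a) * (β a).factorial * b.factorial := by
            rw [← h1, Nat.choose_symm_add]
        _ ≤ 2 ^ (β a + b) * (β a).factorial *
              ((2 ^ S.card) ^ (β a + b) * ∏ i ∈ S, (β i).factorial) := by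
            gcongr
            exact ih.trans (Nat.mul_le_mul_right _
              (Nat.pow_le_pow_right (by positivity) (Nat.le_add_left _ _)))
        _ = (2 ^ (S.card + 1)) ^ (β a + b) * ((β a).factorial * ∏ i ∈ S, (β i).factorial) := by
            rw [pow_succ 2 S.card, mul_pow]; ring
  simpa [multiFactorial] using key Finset.univ

theorem multiDeriv_le_norm {d : ℕ} (β : Fin d → ℕ) (φ : Rd d → ℂ) (x : Rd d) :
    ‖multiDeriv β φ x‖ ≤ ‖iteratedFDeriv ℝ (∑ i, β i) φ x‖ := by
  refine (ContinuousMultilinearMap.le_opNorm _ _).trans ?_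
  simp

/-- Every iterated partial derivative is the one attached to a multi-index. -/
theorem exists_multiDeriv {d : ℕ} {φ : Rd d → ℂ} (hφ : ContDiff ℝ (⊤ : ℕ∞) φ) (n : ℕ)
    (r : Fin n → Fin d) (x : Rd d) : ∃ β : Fin d → ℕ, ∑ i, β i = n ∧
      iteratedFDeriv ℝ n φ x (fun j => EuclideanSpace.single (r j) (1 : ℝ)) =
        multiDeriv β φ x := by
  classical
  obtain ⟨β, e, he⟩ : ∃ β : Fin d → ℕ, ∃ e : (Σ i, Fin (β i)) ≃ Fin n, ∀ p, r (e p) = p.1 :=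
    ⟨fun i => Fintype.card {j // r j = i},
      (Equiv.sigmaCongrRight fun i => (Fintype.equivFin {j // r j = i}).symm).trans
        (Equiv.sigmaFiberEquiv r),
      fun p => ((Fintype.equivFin {j // r j = p.1}).symm p.2).2⟩
  have hsum : ∑ i, β i = n := by
    have := Fintype.card_congr e
    simpa using this
  refine ⟨β, hsum, ?_⟩
  subst hsum
  rw [multiDeriv, ← iteratedFDeriv_perm hφ _ x _ (finSigmaFinEquiv.symm.trans e)]
  congr 1
  funext j
  simp [he]

/-- Bounds on the mixed partial derivatives give bounds on the iterated derivatives. -/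
theorem norm_le_of_gevreyNorm_le {d : ℕ} {s A : ℝ} (hs : 0 ≤ s) (hA : 0 < A)
    {K : Set (Rd d)} {φ : Rd d → ℂ} (hφ : ContDiff ℝ (⊤ : ℕ∞) φ) {M : ℝ} (hM : 0 ≤ M)
    (h : gevreyNorm s A K φ ≤ ENNReal.ofReal M) (n : ℕ) {x : Rd d} (hx : x ∈ K) :
    ‖iteratedFDeriv ℝ n φ x‖ ≤ M * (n.factorial : ℝ) ^ s * (d / A) ^ n := by
  have h1 : ∀ β : Fin d → ℕ, ‖multiDeriv β φ x‖ ≤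
      M * ((∑ i, β i).factorial : ℝ) ^ s * (1 / A) ^ (∑ i, β i) := by
    intro β
    have hb : ENNReal.ofReal (A ^ (∑ i, β i) / (multiFactorial β : ℝ) ^ s * ‖multiDeriv β φ x‖) ≤
        ENNReal.ofReal M := 
      le_trans (le_iSup_of_le β (le_iSup₂ (f := fun x (_ : x ∈ K) => ENNReal.ofReal
        (A ^ (∑ i, β i) / (multiFactorial β : ℝ) ^ s * ‖multiDeriv β φ x‖)) x hx)) h
    rw [ENNReal.ofReal_le_ofReal_iff hM] at hb
    have hpos : (0 : ℝ) < multiFactorial β := by exact_mod_cast multiFactorial_pos β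
    have hpos' : (0 : ℝ) < (multiFactorial β : ℝ) ^ s := Real.rpow_pos_of_pos hpos s
    have hle : (multiFactorial β : ℝ) ^ s ≤ ((∑ i, β i).factorial : ℝ) ^ s :=
      Real.rpow_le_rpow hpos.le (by exact_mod_cast multiFactorial_le β) hs
    have hAp : 0 < A ^ (∑ i, β i) := pow_pos hA _
    have : ‖multiDeriv β φ x‖ ≤ M * (multiFactorial β : ℝ) ^ s * (1 / A) ^ (∑ i, β i) := by
      rw [one_div, inv_pow, ← div_eq_mul_inv, le_div_iff₀ hAp]
      rw [div_mul_eq_mul_div, div_le_iff₀ hpos'] at hb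
      linarith
    refine this.trans ?_
    gcongr
  refine ContinuousMultilinearMap.opNorm_le_bound (by positivity) fun v => ?_
  have hv : ∀ j, v j = ∑ k, (v j k) • EuclideanSpace.single k (1 : ℝ) := by
    intro j
    ext l
    simp [Finset.sum_apply, Pi.single_apply]
  have hexp : iteratedFDeriv ℝ n φ x v = ∑ r : Fin n → Fin d, (∏ j, v j (r j)) •
      iteratedFDeriv ℝ n φ x (fun j => EuclideanSpace.single (r j) (1 : ℝ)) := by
    conv_lhs => rw [show v = fun j => ∑ k, (v j k) • EuclideanSpace.single k (1 : ℝ) from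
      funext hv]
    rw [ContinuousMultilinearMap.map_sum]
    refine Finset.sum_congr rfl fun r _ => ?_
    exact ContinuousMultilinearMap.map_smul_univ _ _ _
  rw [hexp]
  refine (norm_sum_le _ _).trans ?_
  have hterm : ∀ r ∈ (Finset.univ : Finset (Fin n → Fin d)), ‖(∏ j, v j (r j)) •
      iteratedFDeriv ℝ n φ x (fun j => EuclideanSpace.single (r j) (1 : ℝ))‖ ≤
      (∏ j, ‖v j‖) * (M * (n.factorial : ℝ) ^ s * (1 / A) ^ n) := by
    intro r _
    obtain ⟨β, hβ, he⟩ := exists_multiDeriv hφ n r x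
    rw [norm_smul, norm_prod, he]
    have h2 := h1 β
    rw [hβ] at h2
    gcongr with j
    exact PiLp.norm_apply_le (v j) (r j)
  refine (Finset.sum_le_card_nsmul _ _ _ hterm).trans (le_of_eq ?_)
  simp only [Finset.card_univ, Fintype.card_pi, Fintype.card_fin, Finset.prod_const, nsmul_eq_mul]
  push_cast
  rw [div_pow, div_pow]
  ring

/-- Bounds on the iterated derivatives give bounds on the mixed partial derivatives. -/
theorem gevreyNorm_le_of_norm_le {d : ℕ} {s A B C : ℝ} (hs : 0 ≤ s) (hA : 0 ≤ A) (hB : 0 ≤ B)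
    (hC : 0 ≤ C) (hAB : A * B * ((2 : ℝ) ^ d) ^ s ≤ 1) {K : Set (Rd d)} {φ : Rd d → ℂ}
    (h : ∀ n : ℕ, ∀ x ∈ K, ‖iteratedFDeriv ℝ n φ x‖ ≤ C * (n.factorial : ℝ) ^ s * B ^ n) :
    gevreyNorm s A K φ ≤ ENNReal.ofReal C := by
  refine iSup_le fun β => iSup₂_le fun x hx => ENNReal.ofReal_le_ofReal ?_
  set n := ∑ i, β i with hn
  have hpos : (0 : ℝ) < multiFactorial β := by exact_mod_cast multiFactorial_pos β
  have hpos' : (0 : ℝ) < (multiFactorial β : ℝ) ^ s := Real.rpow_pos_of_pos hpos s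
  have hf : (n.factorial : ℝ) ^ s ≤ (((2 : ℝ) ^ d) ^ s) ^ n * (multiFactorial β : ℝ) ^ s := by
    have h1 : (n.factorial : ℝ) ≤ ((2 : ℝ) ^ d) ^ n * multiFactorial β := by
      exact_mod_cast factorial_sum_le β
    refine (Real.rpow_le_rpow (by positivity) h1 hs).trans (le_of_eq ?_)
    rw [Real.mul_rpow (by positivity) hpos.le, Real.rpow_pow_comm (by positivity)]
  calc A ^ n / (multiFactorial β : ℝ) ^ s * ‖multiDeriv β φ x‖
      ≤ A ^ n / (multiFactorial β : ℝ) ^ s *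
          (C * ((((2 : ℝ) ^ d) ^ s) ^ n * (multiFactorial β : ℝ) ^ s) * B ^ n) := by
        gcongr
        refine (multiDeriv_le_norm β φ x).trans ((h n x hx).trans ?_)
        gcongr
    _ = C * (A * B * ((2 : ℝ) ^ d) ^ s) ^ n := by
        rw [mul_pow, mul_pow]; field_simp
    _ ≤ C * 1 := by
        gcongr
        exact pow_le_one₀ (by positivity) hAB
    _ = C := mul_one C

theorem gevreyNorm_anti {d : ℕ} {s A A' : ℝ} (hA : 0 ≤ A) (h : A ≤ A') (K : Set (Rd d))
    (φ : Rd d → ℂ) : gevreyNorm s A K φ ≤ gevreyNorm s A' K φ := by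
  refine iSup_mono fun β => iSup₂_mono fun x _ => ENNReal.ofReal_le_ofReal ?_
  gcongr

theorem gevreyNorm_add_le {d : ℕ} {s A : ℝ} (hA : 0 ≤ A) (K : Set (Rd d)) {φ ψ : Rd d → ℂ}
    (hφ : ContDiff ℝ (⊤ : ℕ∞) φ) (hψ : ContDiff ℝ (⊤ : ℕ∞) ψ) :
    gevreyNorm s A K (φ + ψ) ≤ gevreyNorm s A K φ + gevreyNorm s A K ψ := by
  refine iSup_le fun β => iSup₂_le fun x hx => ?_
  have hadd : multiDeriv β (φ + ψ) x = multiDeriv β φ x + multiDeriv β ψ x := by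
    unfold multiDeriv
    rw [iteratedFDeriv_add_apply (hφ.of_le (by exact_mod_cast le_top)).contDiffAt
      (hψ.of_le (by exact_mod_cast le_top)).contDiffAt]
    rfl
  have hle : ∀ χ : Rd d → ℂ, ENNReal.ofReal
      (A ^ (∑ i, β i) / (multiFactorial β : ℝ) ^ s * ‖multiDeriv β χ x‖) ≤ gevreyNorm s A K χ :=
    fun χ => le_iSup_of_le β (le_iSup₂ (f := fun x (_ : x ∈ K) => ENNReal.ofReal
      (A ^ (∑ i, β i) / (multiFactorial β : ℝ) ^ s * ‖multiDeriv β χ x‖)) x hx)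
  refine le_trans ?_ (add_le_add (hle φ) (hle ψ))
  rw [← ENNReal.ofReal_add (by positivity) (by positivity), ← mul_add, hadd]
  apply ENNReal.ofReal_le_ofReal
  gcongr
  exact norm_add_le _ _

theorem gevreyNorm_smul_le {d : ℕ} {s A : ℝ} (K : Set (Rd d)) (c : ℂ)
    {φ : Rd d → ℂ} (hφ : ContDiff ℝ (⊤ : ℕ∞) φ) :
    gevreyNorm s A K (c • φ) ≤ ENNReal.ofReal ‖c‖ * gevreyNorm s A K φ := by
  refine iSup_le fun β => iSup₂_le fun x hx => ?_
  have hsm : multiDeriv β (c • φ) x = c * multiDeriv β φ x := by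
    unfold multiDeriv
    rw [iteratedFDeriv_const_smul_apply (hφ.of_le (by exact_mod_cast le_top)).contDiffAt]
    rfl
  have hle : ENNReal.ofReal
      (A ^ (∑ i, β i) / (multiFactorial β : ℝ) ^ s * ‖multiDeriv β φ x‖) ≤ gevreyNorm s A K φ :=
    le_iSup_of_le β (le_iSup₂ (f := fun x (_ : x ∈ K) => ENNReal.ofReal
      (A ^ (∑ i, β i) / (multiFactorial β : ℝ) ^ s * ‖multiDeriv β φ x‖)) x hx)
  refine le_trans (le_of_eq ?_) (mul_le_mul_right hle _)
  rw [← ENNReal.ofReal_mul (norm_nonneg _), hsm, norm_mul]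
  congr 1; ring

/-- The Leibniz estimate. -/
theorem gevreyNorm_mul_le {d : ℕ} {s A₁ A₂ A : ℝ} (hs : 0 ≤ s) (hA₁ : 0 < A₁) (hA₂ : 0 < A₂)
    (hA : 0 ≤ A) (hAA : A * (d / A₁ + d / A₂) * ((2 : ℝ) ^ d) ^ s ≤ 1) {K : Set (Rd d)}
    {φ ψ : Rd d → ℂ} (hφ : ContDiff ℝ (⊤ : ℕ∞) φ) (hψ : ContDiff ℝ (⊤ : ℕ∞) ψ) {M₁ M₂ : ℝ} (hM₁ : 0 ≤ M₁)
    (hM₂ : 0 ≤ M₂) (h₁ : gevreyNorm s A₁ K φ ≤ ENNReal.ofReal M₁)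
    (h₂ : gevreyNorm s A₂ K ψ ≤ ENNReal.ofReal M₂) :
    gevreyNorm s A K (φ * ψ) ≤ ENNReal.ofReal (M₁ * M₂) := by
  refine gevreyNorm_le_of_norm_le hs hA (by positivity) (by positivity) hAA fun n x hx => ?_
  refine (norm_iteratedFDeriv_mul_le hφ hψ x (n := n) (by exact_mod_cast le_top)).trans ?_
  rw [add_pow, Finset.mul_sum]
  refine Finset.sum_le_sum fun i hi => ?_
  have hin : i ≤ n := Nat.lt_succ_iff.mp (Finset.mem_range.mp hi)
  have hfac : (i.factorial : ℝ) ^ s * ((n - i).factorial : ℝ) ^ s ≤ (n.factorial : ℝ) ^ s := by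
    rw [← Real.mul_rpow (by positivity) (by positivity)]
    refine Real.rpow_le_rpow (by positivity) ?_ hs
    exact_mod_cast Nat.le_of_dvd (Nat.factorial_pos _)
      (Nat.factorial_mul_factorial_dvd_factorial hin)
  calc (n.choose i : ℝ) * ‖iteratedFDeriv ℝ i φ x‖ * ‖iteratedFDeriv ℝ (n - i) ψ x‖
      ≤ n.choose i * (M₁ * (i.factorial : ℝ) ^ s * (d / A₁) ^ i) *
          (M₂ * ((n - i).factorial : ℝ) ^ s * (d / A₂) ^ (n - i)) := by
        gcongr
        · exact norm_le_of_gevreyNorm_le hs hA₁ hφ hM₁ h₁ i hx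
        · exact norm_le_of_gevreyNorm_le hs hA₂ hψ hM₂ h₂ (n - i) hx
    _ = M₁ * M₂ * ((i.factorial : ℝ) ^ s * ((n - i).factorial : ℝ) ^ s) *
          ((d / A₁) ^ i * (d / A₂) ^ (n - i) * n.choose i) := by ring
    _ ≤ M₁ * M₂ * (n.factorial : ℝ) ^ s *
          ((d / A₁) ^ i * (d / A₂) ^ (n - i) * n.choose i) := by gcongr

theorem exists_radius (d : ℕ) (s B : ℝ) (hB : 0 ≤ B) :
    ∃ A : ℝ, 0 < A ∧ A * B * ((2 : ℝ) ^ d) ^ s ≤ 1 := by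
  refine ⟨1 / (B * ((2 : ℝ) ^ d) ^ s + 1), by positivity, ?_⟩
  rw [mul_assoc, one_div_mul_eq_div, div_le_one (by positivity)]
  linarith

/-- `⋃_{A > 0} 𝓔^s_{A,K}`: the smooth functions on `ℝ^d` with `‖φ‖_{s,A,K} < ∞` for some `A > 0`. -/
def gevreySubmodule (d : ℕ) (s : ℝ) (K : Set (Rd d)) : Submodule ℂ (Rd d → ℂ) where
  carrier := {φ | ContDiff ℝ (⊤ : ℕ∞) φ ∧ ∃ A : ℝ, 0 < A ∧ gevreyNorm s A K φ < ∞}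
  zero_mem' := by
    refine ⟨contDiff_const, 1, one_pos, lt_of_le_of_lt (b := 0) ?_ ENNReal.zero_lt_top⟩
    refine iSup_le fun β => iSup₂_le fun x _ => ?_
    have : multiDeriv β (0 : Rd d → ℂ) x = 0 := by
      unfold multiDeriv; simp
    simp [this]
  add_mem' := by
    rintro φ ψ ⟨hφ, A, hA, h⟩ ⟨hψ, A', hA', h'⟩
    refine ⟨hφ.add hψ, min A A', lt_min hA hA', ?_⟩
    refine (gevreyNorm_add_le (lt_min hA hA').le K hφ hψ).trans_lt (ENNReal.add_lt_top.2 ⟨?_, ?_⟩)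
    · exact (gevreyNorm_anti (lt_min hA hA').le (min_le_left _ _) K φ).trans_lt h
    · exact (gevreyNorm_anti (lt_min hA hA').le (min_le_right _ _) K ψ).trans_lt h'
  smul_mem' := by
    rintro c φ ⟨hφ, A, hA, h⟩
    exact ⟨contDiff_const.smul hφ, A, hA, (gevreyNorm_smul_le K c hφ).trans_lt
      (ENNReal.mul_lt_top ENNReal.ofReal_lt_top h)⟩

/-- The space `ind lim_{A → 0} 𝓔^s_{A,K}`; its inductive limit topology is given below. -/
def GevreyOn (d : ℕ) (s : ℝ) (K : Set (Rd d)) : Type := gevreySubmodule d s K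

noncomputable instance (d : ℕ) (s : ℝ) (K : Set (Rd d)) : AddCommGroup (GevreyOn d s K) :=
  inferInstanceAs (AddCommGroup (gevreySubmodule d s K))

noncomputable instance (d : ℕ) (s : ℝ) (K : Set (Rd d)) : Module ℂ (GevreyOn d s K) :=
  inferInstanceAs (Module ℂ (gevreySubmodule d s K))

/-- The underlying function. -/
def GevreyOn.fn {d : ℕ} {s : ℝ} {K : Set (Rd d)} (φ : GevreyOn d s K) : Rd d → ℂ :=
  Subtype.val φ

/-- A function in `⋃_A 𝓔^s_{A,K}` as an element of the space. -/
def GevreyOn.mk {d : ℕ} {s : ℝ} {K : Set (Rd d)} (φ : Rd d → ℂ) (h : φ ∈ gevreySubmodule d s K) :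
    GevreyOn d s K := Subtype.mk φ h

/-- A seminorm on `⋃_A 𝓔^s_{A,K}` whose restriction to each `𝓔^s_{A,K}` is continuous for
`‖·‖_{s,A,K}`. (Where `‖φ‖_{s,A,K} = ∞` the inequality is no condition, since `C` may be taken
positive.) -/
def IsInductiveSeminorm {d : ℕ} {s : ℝ} {K : Set (Rd d)}
    (p : Seminorm ℂ (GevreyOn d s K)) : Prop :=
  ∀ A : ℝ, 0 < A → ∃ C : ℝ≥0, ∀ φ : GevreyOn d s K,
    ENNReal.ofReal (p φ) ≤ C * gevreyNorm s A K φ.fn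

/-- All seminorms that are continuous on every step of the inductive limit. -/
def inductiveFamily (d : ℕ) (s : ℝ) (K : Set (Rd d)) :
    SeminormFamily ℂ (GevreyOn d s K) {p : Seminorm ℂ (GevreyOn d s K) // IsInductiveSeminorm p} :=
  fun p => p.1

instance (d : ℕ) (s : ℝ) (K : Set (Rd d)) :
    Nonempty {p : Seminorm ℂ (GevreyOn d s K) // IsInductiveSeminorm p} :=
  ⟨⟨0, fun _ _ => ⟨0, fun _ => by simp⟩⟩⟩

/-- The locally convex inductive limit topology: the finest locally convex topology for which all
the inclusions of the `𝓔^s_{A,K}` are continuous, that is, the topology defined by all seminorms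
that are continuous on every `𝓔^s_{A,K}`. -/
noncomputable instance (d : ℕ) (s : ℝ) (K : Set (Rd d)) : TopologicalSpace (GevreyOn d s K) :=
  (inductiveFamily d s K).moduleFilterBasis.topology

/-- The functions in `𝓔^{s}(ℝ^d)` (Roumieu case): for every compact `K` there is `A > 0` with
`‖φ‖_{s,A,K} < ∞`. -/
def roumieuSubmodule (d : ℕ) (s : ℝ) : Submodule ℂ (Rd d → ℂ) :=
  ⨅ K : TopologicalSpace.Compacts (Rd d), gevreySubmodule d s K

/-- The space `𝓔^{s}(ℝ^d) = proj lim_K ind lim_{A → 0} 𝓔^s_{A,K}`; its topology is given below. -/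
def RoumieuSpace (d : ℕ) (s : ℝ) : Type := roumieuSubmodule d s

noncomputable instance (d : ℕ) (s : ℝ) : AddCommGroup (RoumieuSpace d s) :=
  inferInstanceAs (AddCommGroup (roumieuSubmodule d s))

noncomputable instance (d : ℕ) (s : ℝ) : Module ℂ (RoumieuSpace d s) :=
  inferInstanceAs (Module ℂ (roumieuSubmodule d s))

/-- The underlying function. -/
def RoumieuSpace.fn {d : ℕ} {s : ℝ} (φ : RoumieuSpace d s) : Rd d → ℂ := Subtype.val φ

/-- A function in `𝓔^{s}(ℝ^d)` as an element of the space. -/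
def RoumieuSpace.mk {d : ℕ} {s : ℝ} (φ : Rd d → ℂ) (h : φ ∈ roumieuSubmodule d s) :
    RoumieuSpace d s := Subtype.mk φ h

theorem GevreyOn.fn_mem {d : ℕ} {s : ℝ} {K : Set (Rd d)} (φ : GevreyOn d s K) :
    φ.fn ∈ gevreySubmodule d s K := Subtype.property φ

theorem RoumieuSpace.fn_mem {d : ℕ} {s : ℝ} (φ : RoumieuSpace d s)
    (K : TopologicalSpace.Compacts (Rd d)) : φ.fn ∈ gevreySubmodule d s K :=
  (Submodule.mem_iInf _).1 (Subtype.property φ) K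

/-- The canonical map from the projective limit to the step that belongs to `K`. -/
def toGevreyOn {d : ℕ} {s : ℝ} (K : TopologicalSpace.Compacts (Rd d)) :
    RoumieuSpace d s →ₗ[ℂ] GevreyOn d s K where
  toFun φ := GevreyOn.mk φ.fn (φ.fn_mem K)
  map_add' _ _ := rfl
  map_smul' _ _ := rfl

/-- The projective limit topology over all compact sets (an exhausting sequence is cofinal). -/
noncomputable instance (d : ℕ) (s : ℝ) : TopologicalSpace (RoumieuSpace d s) :=
  ⨅ K : TopologicalSpace.Compacts (Rd d),
    TopologicalSpace.induced (toGevreyOn (s := s) K) inferInstance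

/-- `(𝓔^{s})'(ℝ^d)`: the compactly supported ultradistributions of Roumieu type, i.e. the
continuous linear functionals on `𝓔^{s}(ℝ^d)`. -/
abbrev CompactUltradistribution (d : ℕ) (s : ℝ) : Type := RoumieuSpace d s →L[ℂ] ℂ

theorem mul_mem_gevreySubmodule {d : ℕ} {s : ℝ} (hs : 1 < s) {K : Set (Rd d)} {φ ψ : Rd d → ℂ}
    (hφ : φ ∈ gevreySubmodule d s K) (hψ : ψ ∈ gevreySubmodule d s K) :
    φ * ψ ∈ gevreySubmodule d s K := by
  obtain ⟨hφ, A₁, hA₁, h₁⟩ := hφ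
  obtain ⟨hψ, A₂, hA₂, h₂⟩ := hψ
  obtain ⟨A, hA, hAA⟩ := exists_radius d s (d / A₁ + d / A₂) (by positivity)
  refine ⟨hφ.mul hψ, A, hA, (gevreyNorm_mul_le (by linarith) hA₁ hA₂ hA.le hAA hφ hψ
    ENNReal.toReal_nonneg ENNReal.toReal_nonneg (ENNReal.ofReal_toReal h₁.ne).ge
    (ENNReal.ofReal_toReal h₂.ne).ge).trans_lt ENNReal.ofReal_lt_top⟩

noncomputable def mulOn {d : ℕ} {s : ℝ} (hs : 1 < s) {K : Set (Rd d)} (ψ : GevreyOn d s K) :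
    GevreyOn d s K →ₗ[ℂ] GevreyOn d s K where
  toFun φ := GevreyOn.mk (ψ.fn * φ.fn) (mul_mem_gevreySubmodule hs ψ.fn_mem φ.fn_mem)
  map_add' φ₁ φ₂ := Subtype.ext (mul_add ψ.fn φ₁.fn φ₂.fn)
  map_smul' c φ := Subtype.ext (mul_smul_comm c ψ.fn φ.fn)

theorem isInductiveSeminorm_comp_mulOn {d : ℕ} {s : ℝ} (hs : 1 < s) {K : Set (Rd d)}
    (ψ : GevreyOn d s K) {p : Seminorm ℂ (GevreyOn d s K)} (hp : IsInductiveSeminorm p) :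
    IsInductiveSeminorm (p.comp (mulOn hs ψ)) := by
  intro A hA
  obtain ⟨hψ, A₁, hA₁, h₁⟩ := ψ.fn_mem
  obtain ⟨A', hA', hAA⟩ := exists_radius d s (d / A₁ + d / A) (by positivity)
  obtain ⟨C, hC⟩ := hp A' hA'
  set M := (gevreyNorm s A₁ K ψ.fn).toNNReal with hM
  refine ⟨C * M + 1, fun φ => ?_⟩
  by_cases htop : gevreyNorm s A K φ.fn = ∞
  · rw [htop, ENNReal.mul_top (by simp)]
    exact le_top
  · have hb := gevreyNorm_mul_le (by linarith) hA₁ hA hA'.le hAA hψ φ.fn_mem.1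
      ENNReal.toReal_nonneg ENNReal.toReal_nonneg (ENNReal.ofReal_toReal h₁.ne).ge
      (ENNReal.ofReal_toReal htop).ge
    rw [ENNReal.ofReal_mul ENNReal.toReal_nonneg, ENNReal.ofReal_toReal h₁.ne,
      ENNReal.ofReal_toReal htop] at hb
    calc ENNReal.ofReal (p (mulOn hs ψ φ))
        ≤ C * gevreyNorm s A' K (ψ.fn * φ.fn) := hC (mulOn hs ψ φ)
      _ ≤ C * (gevreyNorm s A₁ K ψ.fn * gevreyNorm s A K φ.fn) := by gcongr
      _ = (C * M : ℝ≥0∞) * gevreyNorm s A K φ.fn := by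
          rw [hM, ENNReal.coe_toNNReal h₁.ne, mul_assoc]
      _ ≤ _ := by
          gcongr
          push_cast
          exact le_self_add

theorem continuous_mulOn {d : ℕ} {s : ℝ} (hs : 1 < s) {K : Set (Rd d)} (ψ : GevreyOn d s K) :
    Continuous (mulOn hs ψ) := by
  have hw : WithSeminorms (inductiveFamily d s K) := ⟨rfl⟩
  refine WithSeminorms.continuous_of_isBounded hw hw (mulOn hs ψ) fun p =>
    ⟨{⟨p.1.comp (mulOn hs ψ), isInductiveSeminorm_comp_mulOn hs ψ p.2⟩}, 1, ?_⟩
  rw [Finset.sup_singleton, one_smul]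
  exact le_rfl

/-- Multiplication by `ψ ∈ 𝓔^{s}(ℝ^d)` as a continuous operator on `𝓔^{s}(ℝ^d)`. -/
noncomputable def mulTest {d : ℕ} {s : ℝ} (hs : 1 < s) (ψ : RoumieuSpace d s) :
    RoumieuSpace d s →L[ℂ] RoumieuSpace d s where
  toFun φ := RoumieuSpace.mk (ψ.fn * φ.fn) ((Submodule.mem_iInf _).2 fun K =>
    mul_mem_gevreySubmodule hs (ψ.fn_mem K) (φ.fn_mem K))
  map_add' φ₁ φ₂ := Subtype.ext (mul_add ψ.fn φ₁.fn φ₂.fn)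
  map_smul' c φ := Subtype.ext (mul_smul_comm c ψ.fn φ.fn)
  cont := by
    refine continuous_iInf_rng.2 fun K => continuous_induced_rng.2 ?_
    have hK : Continuous (toGevreyOn (s := s) K) :=
      continuous_iInf_dom (i := K) continuous_induced_dom
    exact (continuous_mulOn hs (toGevreyOn K ψ)).comp hK

/-- The product `ψ f`, `⟨ψ f, φ⟩ = ⟨f, ψ φ⟩`. -/
noncomputable def mulUltra {d : ℕ} {s : ℝ} (hs : 1 < s) (ψ : RoumieuSpace d s)
    (f : CompactUltradistribution d s) : CompactUltradistribution d s :=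
  f.comp (mulTest hs ψ)

/-- `x ↦ exp (-i ⟨x, ξ⟩)` -/
noncomputable def expFun {d : ℕ} (ξ x : Rd d) : ℂ :=
  Complex.exp (-(Complex.I * (inner ℝ x ξ : ℝ)))

theorem contDiff_expFun {d : ℕ} (ξ : Rd d) : ContDiff ℝ (⊤ : ℕ∞) (expFun ξ) := by
  unfold expFun
  have : ContDiff ℝ (⊤ : ℕ∞) fun x : Rd d => ((inner ℝ x ξ : ℝ) : ℂ) :=
    Complex.ofRealCLM.contDiff.comp (contDiff_id.inner ℝ contDiff_const)
  exact (contDiff_const.mul this).neg.cexp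

theorem norm_iteratedFDeriv_expFun_le {d : ℕ} (ξ : Rd d) (n : ℕ) (x : Rd d) :
    ‖iteratedFDeriv ℝ n (expFun ξ) x‖ ≤ ‖ξ‖ ^ n := by
  let g : ℝ → ℂ := fun t => Complex.exp ((-Complex.I) * t)
  have hg : ContDiff ℝ n g := (contDiff_const.mul Complex.ofRealCLM.contDiff).cexp
  have hcomp : expFun ξ = g ∘ (innerSL ℝ ξ) := by
    funext y
    simp [expFun, g, real_inner_comm]
  have hder : ∀ (n : ℕ) (t : ℝ), iteratedDeriv n g t = (-Complex.I) ^ n * g t := by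
    intro n
    induction n with
    | zero => intro t; simp
    | succ n ih =>
      intro t
      rw [iteratedDeriv_succ, show iteratedDeriv n g = fun t => (-Complex.I) ^ n * g t from
        funext ih]
      have h1 : HasDerivAt g (g t * (-Complex.I * 1)) t :=
        ((Complex.ofRealCLM.hasDerivAt (x := t)).const_mul (-Complex.I)).cexp
      rw [(h1.const_mul _).deriv]
      ring
  rw [hcomp, ContinuousLinearMap.iteratedFDeriv_comp_right _ hg x le_rfl]
  refine (ContinuousMultilinearMap.norm_compContinuousLinearMap_le _ _).trans ?_
  rw [norm_iteratedFDeriv_eq_norm_iteratedDeriv, hder]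
  simp only [Finset.prod_const, Finset.card_univ, Fintype.card_fin, innerSL_apply_norm]
  have : ‖(-Complex.I) ^ n * g (innerSL ℝ ξ x)‖ = 1 := by
    have h2 : ‖g (innerSL ℝ ξ x)‖ = 1 := by
      simp [g, Complex.norm_exp]
    rw [norm_mul, h2]; simp
  rw [this, one_mul]

theorem expFun_mem {d : ℕ} {s : ℝ} (hs : 1 < s) (ξ : Rd d) :
    expFun ξ ∈ roumieuSubmodule d s := by
  refine (Submodule.mem_iInf _).2 fun K => ⟨contDiff_expFun ξ, ?_⟩
  obtain ⟨A, hA, hAB⟩ := exists_radius d s 1 zero_le_one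
  refine ⟨A, hA, (gevreyNorm_le_of_norm_le (by linarith) hA.le zero_le_one
    (Real.exp_nonneg ‖ξ‖) hAB fun n x _ => ?_).trans_lt ENNReal.ofReal_lt_top⟩
  have h1 := Real.pow_div_factorial_le_exp _ (norm_nonneg ξ) n
  have hf : (1 : ℝ) ≤ n.factorial := by exact_mod_cast Nat.factorial_pos n
  rw [div_le_iff₀ (by positivity)] at h1
  have h2 : (n.factorial : ℝ) ≤ (n.factorial : ℝ) ^ s := Real.self_le_rpow_of_one_le hf hs.le
  calc ‖iteratedFDeriv ℝ n (expFun ξ) x‖ ≤ ‖ξ‖ ^ n := norm_iteratedFDeriv_expFun_le ξ n x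
    _ ≤ Real.exp ‖ξ‖ * n.factorial := h1
    _ ≤ Real.exp ‖ξ‖ * (n.factorial : ℝ) ^ s * 1 ^ n := by
        rw [one_pow, mul_one]; gcongr

/-- The Fourier transform `(2π)^{-d/2} ⟨f, exp (-i ⟨·, ξ⟩)⟩` of a compactly supported
ultradistribution. -/
noncomputable def ultraFourier {d : ℕ} {s : ℝ} (hs : 1 < s) (f : CompactUltradistribution d s)
    (ξ : Rd d) : ℂ :=
  (((2 * Real.pi) ^ (-(d : ℝ) / 2) : ℝ) : ℂ) * f (RoumieuSpace.mk (expFun ξ) (expFun_mem hs ξ))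

/-- The support: the complement of the union of all open sets `U` on which `f` vanishes, i.e.
`⟨f, φ⟩ = 0` for all `φ ∈ 𝓓^{s}(U)`. -/
def ultraSupport {d : ℕ} {s : ℝ} (f : CompactUltradistribution d s) : Set (Rd d) :=
  (⋃₀ {U : Set (Rd d) | IsOpen U ∧ ∀ φ : RoumieuSpace d s,
    HasCompactSupport φ.fn → tsupport φ.fn ⊆ U → f φ = 0})ᶜ

/-- `𝓓^(s)(X)` (Beurling case), the functions being extended by zero outside `X`: smooth, with
support in some compact `K ⊆ X`, and `‖φ‖_{s,A,K} < ∞` for every `A > 0`. -/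
def beurlingTest {d : ℕ} (s : ℝ) (X : Set (Rd d)) : Set (Rd d → ℂ) :=
  {φ | ContDiff ℝ (⊤ : ℕ∞) φ ∧ ∃ K : Set (Rd d), IsCompact K ∧ K ⊆ X ∧ tsupport φ ⊆ K ∧
    ∀ A : ℝ, 0 < A → gevreyNorm s A K φ < ∞}

theorem beurlingTest_subset {d : ℕ} {s : ℝ} {X : Set (Rd d)} {φ : Rd d → ℂ}
    (h : φ ∈ beurlingTest s X) : φ ∈ roumieuSubmodule d s := by
  obtain ⟨hφ, K, -, -, hK, hA⟩ := h
  refine (Submodule.mem_iInf _).2 fun K' => ⟨hφ, 1, one_pos, ?_⟩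
  refine lt_of_le_of_lt ?_ (hA 1 one_pos)
  refine iSup_le fun β => iSup₂_le fun x _ => ?_
  by_cases hx : x ∈ K
  · exact le_iSup_of_le β (le_iSup₂ (f := fun x (_ : x ∈ K) => ENNReal.ofReal
      ((1 : ℝ) ^ (∑ i, β i) / (multiFactorial β : ℝ) ^ s * ‖multiDeriv β φ x‖)) x hx)
  · have h0 : iteratedFDeriv ℝ (∑ i, β i) φ x = 0 := by
      by_contra hne
      exact hx (hK (support_iteratedFDeriv_subset _ hne))
    have : multiDeriv β φ x = 0 := by
      unfold multiDeriv; rw [h0]; rfl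
    simp [this]

/-- `v` is submultiplicative. -/
def IsSubmultiplicative {d : ℕ} (v : Rd d → ℝ) : Prop :=
  ∀ x y, v (x + y) ≤ v x * v y

/-- `ω` is `v`-moderate. -/
def IsModerate {d : ℕ} (v ω : Rd d → ℝ) : Prop :=
  ∃ C : ℝ, 0 < C ∧ ∀ x y, ω (x + y) ≤ C * v x * ω y

/-- The weights in `𝓜_{s}(ℝ^d)`: non-negative functions that are moderate with respect to some
submultiplicative weight `v ≤ C exp (k |·|^{1/s})`. -/
def roumieuWeights (d : ℕ) (s : ℝ) : Set (Rd d → ℝ) :=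
  {ω | (∀ x, 0 ≤ ω x) ∧ ∃ v : Rd d → ℝ, (∀ x, 0 ≤ v x) ∧ IsSubmultiplicative v ∧
    (∃ C k : ℝ, 0 < C ∧ 0 < k ∧ ∀ x, v x ≤ C * Real.exp (k * ‖x‖ ^ (1 / s))) ∧
    IsModerate v ω}

/-- The discrete seminorm `(∑_{ξ ∈ H} |f̂(ξ) ω(ξ)|^q)^{1/q}` (the supremum if `q = ∞`), with value
in `[0,∞]`. -/
noncomputable def discreteSeminorm {d : ℕ} {s : ℝ} (hs : 1 < s) (q : ℝ≥0∞) (ω : Rd d → ℝ)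
    (H : Set (Rd d)) (f : CompactUltradistribution d s) : ℝ≥0∞ :=
  if q = ∞ then ⨆ ξ ∈ H, ‖ultraFourier hs f ξ * ω ξ‖ₑ
  else (∑' ξ : H, ‖ultraFourier hs f ξ * ω ξ‖ₑ ^ q.toReal) ^ (1 / q.toReal)

/-- The lattice `{a₁ e₁ + ⋯ + a_d e_d : a_j ∈ ℤ}` of a basis of `ℝ^d`. -/
def latticeOf {d : ℕ} (e : Module.Basis (Fin d) ℝ (Rd d)) : Set (Rd d) :=
  {x | ∃ a : Fin d → ℤ, x = ∑ j, (a j : ℝ) • e j}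

/-- Admissible lattice pairs: `⟨e_j, ε_j⟩ = c` for all `j` with some `0 < c ≤ 2π`, and
`⟨e_j, ε_k⟩ = 0` for `j ≠ k`. -/
def IsAdmissibleLatticePair {d : ℕ} (Λ₁ Λ₂ : Set (Rd d)) : Prop :=
  ∃ e ε : Module.Basis (Fin d) ℝ (Rd d), Λ₁ = latticeOf e ∧ Λ₂ = latticeOf ε ∧
    ∃ c : ℝ, 0 < c ∧ c ≤ 2 * Real.pi ∧ (∀ j, inner ℝ (e j) (ε j) = c) ∧
      ∀ j k, j ≠ k → inner ℝ (e j) (ε k) = 0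

/-- `𝓐(Λ)`: the `Λ`-parallelepipeds `{x₀ + t₁ e₁ + ⋯ + t_d e_d : t_j ∈ [0,1]}`, where `x₀ ∈ Λ` and
`e₁, …, e_d` is any basis for `Λ`. -/
def parallelepipeds {d : ℕ} (Λ : Set (Rd d)) : Set (Set (Rd d)) :=
  {D | ∃ x₀ ∈ Λ, ∃ e : Module.Basis (Fin d) ℝ (Rd d), Λ = latticeOf e ∧
    D = {x | ∃ t : Fin d → ℝ, (∀ j, t j ∈ Set.Icc (0 : ℝ) 1) ∧ x = x₀ + ∑ j, t j • e j}}

/-- Open cones: open sets that are invariant under multiplication by positive scalars. -/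
def IsOpenCone {d : ℕ} (Γ : Set (Rd d)) : Prop :=
  IsOpen Γ ∧ ∀ x ∈ Γ, ∀ t : ℝ, 0 < t → t • x ∈ Γ

end Roumieu

open Roumieu

/-! Multiplication by `φ` becomes a convolution over the lattice `Λ₂` itself. Take a Gevrey cut-off
`χ` that equals `1` near the support of `f` and is supported in the neighbourhood `U ⊆ D₁`. Then
`χφ` and `φ` agree near the support, so they give the same product with `f`. Since `c ≤ 2π`, the
parallelepiped `D₁` fits into one period cell of the characters with frequencies in `Λ₂`. Hence `χφ`
is on `U` a series `∑ b_n exp(i⟨x, y_n⟩)` with `y_n ∈ Λ₂`. The Beurling condition on `φ` gives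
`|b_n| ≤ C exp(-N|y_n|^{1/s})` for any `N` prescribed in advance (`exists_fourier_expansion`).
Applying `f` termwise turns the transform of `φf` at `ξ` into `∑ b_n f̂(ξ - y_n)`
(`ultraFourier_mulUltra`), and `ξ - y_n` stays in `Λ₂` when `ξ` does.

For `ξ ∈ Γ₀` the sum splits (`exists_pointwise_bound`). If `ξ - y_n ∈ Γ`, moderateness replaces
`ω(ξ)` by `ω(ξ - y_n)` at the price of `exp(k|y_n|^{1/s})`, and what remains is the sequence assumed
to be in `ℓ^q`. If `ξ - y_n ∉ Γ`, the cones are separated, so `|ξ|` and `|ξ - y_n|` are at most a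
constant times `|y_n|`. The a priori growth of `f̂` and `ω` is then a fixed exponential in
`|y_n|^{1/s}`. A large `N` absorbs both prices and leaves a summable remainder. The claim follows
from `ℓ¹ * ℓ^q ⊆ ℓ^q` (`LqFinite.convolution`).

Two supports of the argument need work. The cut-offs are built from `exp(-x^{-m})`, whose Gevrey
order `1 + 1/m` can be brought below `s`. The topology of the test space enters only through
`exists_gevreyNorm_bound`: one compact set serves all radii `A`. This gives the growth of `f̂`,
termwise application to series, and, with cut-offs, the vanishing of `f` on functions that vanish
near its support. -/

open Filter Topology Set
open scoped FourierTransform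

/-! ### Global Gevrey bounds of Beurling type and their stability -/

section
variable {E F : Type*} [NormedAddCommGroup E] [NormedSpace ℝ E] [NormedAddCommGroup F]
  [NormedSpace ℝ F]

/-- Smooth functions all of whose derivatives satisfy the Beurling type Gevrey bounds of order `s`,
uniformly on the whole space. -/
def UniformBeurling (s : ℝ) (g : E → ℂ) : Prop :=
  ContDiff ℝ (⊤ : ℕ∞) g ∧ ∀ B : ℝ, 0 < B → ∃ M : ℝ, 0 ≤ M ∧ ∀ (n : ℕ) (x : E),
    ‖iteratedFDeriv ℝ n g x‖ ≤ M * (n.factorial : ℝ) ^ s * B ^ n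

theorem UniformBeurling.const (s : ℝ) (c : ℂ) : UniformBeurling s (fun _ : E => c) := by
  refine ⟨contDiff_const, fun B hB => ⟨‖c‖, norm_nonneg c, fun n x => ?_⟩⟩
  rcases n with _ | n
  · simp
  · rw [iteratedFDeriv_const_of_ne (by simp)]
    simp only [Pi.zero_apply, norm_zero]
    positivity

theorem UniformBeurling.add {s : ℝ} {g h : E → ℂ} (hg : UniformBeurling s g)
    (hh : UniformBeurling s h) : UniformBeurling s (fun x => g x + h x) := by
  refine ⟨hg.1.add hh.1, fun B hB => ?_⟩
  obtain ⟨M, hM, h1⟩ := hg.2 B hB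
  obtain ⟨N, hN, h2⟩ := hh.2 B hB
  refine ⟨M + N, add_nonneg hM hN, fun n x => ?_⟩
  change ‖iteratedFDeriv ℝ n (g + h) x‖ ≤ _
  rw [iteratedFDeriv_add_apply (hg.1.of_le (by exact_mod_cast le_top)).contDiffAt
    (hh.1.of_le (by exact_mod_cast le_top)).contDiffAt]
  refine (norm_add_le _ _).trans ((add_le_add (h1 n x) (h2 n x)).trans (le_of_eq (by ring)))

theorem factorial_rpow_mul_le {s : ℝ} (hs : 0 ≤ s) {i n : ℕ} (hin : i ≤ n) :
    (i.factorial : ℝ) ^ s * ((n - i).factorial : ℝ) ^ s ≤ (n.factorial : ℝ) ^ s := by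
  rw [← Real.mul_rpow (by positivity) (by positivity)]
  refine Real.rpow_le_rpow (by positivity) ?_ hs
  exact_mod_cast Nat.le_of_dvd (Nat.factorial_pos _)
    (Nat.factorial_mul_factorial_dvd_factorial hin)

theorem UniformBeurling.mul {s : ℝ} (hs : 0 ≤ s) {g h : E → ℂ} (hg : UniformBeurling s g)
    (hh : UniformBeurling s h) : UniformBeurling s (fun x => g x * h x) := by
  refine ⟨hg.1.mul hh.1, fun B hB => ?_⟩
  -- With `B / 2` for both factors the Leibniz sum is the binomial expansion of `B ^ n`.
  obtain ⟨M, hM, h1⟩ := hg.2 (B / 2) (by positivity)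
  obtain ⟨N, hN, h2⟩ := hh.2 (B / 2) (by positivity)
  refine ⟨M * N, mul_nonneg hM hN, fun n x => ?_⟩
  refine (norm_iteratedFDeriv_mul_le hg.1 hh.1 x (n := n) (by exact_mod_cast le_top)).trans ?_
  have hB2 : B ^ n = (B / 2 + B / 2) ^ n := by ring
  rw [hB2, add_pow, Finset.mul_sum]
  refine Finset.sum_le_sum fun i hi => ?_
  have hin : i ≤ n := Nat.lt_succ_iff.mp (Finset.mem_range.mp hi)
  calc (n.choose i : ℝ) * ‖iteratedFDeriv ℝ i g x‖ * ‖iteratedFDeriv ℝ (n - i) h x‖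
      ≤ n.choose i * (M * (i.factorial : ℝ) ^ s * (B / 2) ^ i) *
          (N * ((n - i).factorial : ℝ) ^ s * (B / 2) ^ (n - i)) := by
        gcongr
        · exact h1 i x
        · exact h2 (n - i) x
    _ = M * N * ((i.factorial : ℝ) ^ s * ((n - i).factorial : ℝ) ^ s) *
          ((B / 2) ^ i * (B / 2) ^ (n - i) * n.choose i) := by ring
    _ ≤ M * N * (n.factorial : ℝ) ^ s *
          ((B / 2) ^ i * (B / 2) ^ (n - i) * n.choose i) := by
        gcongr
        exact factorial_rpow_mul_le hs hin

theorem UniformBeurling.sub {s : ℝ} (hs : 0 ≤ s) {g h : E → ℂ} (hg : UniformBeurling s g)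
    (hh : UniformBeurling s h) : UniformBeurling s (fun x => g x - h x) := by
  have := hg.add ((UniformBeurling.const s (-1)).mul hs hh)
  simpa [sub_eq_add_neg] using this

theorem UniformBeurling.prod {s : ℝ} (hs : 0 ≤ s) {ι : Type*} (S : Finset ι) {g : ι → E → ℂ}
    (hg : ∀ i ∈ S, UniformBeurling s (g i)) : UniformBeurling s (fun x => ∏ i ∈ S, g i x) := by
  classical
  induction S using Finset.induction_on with
  | empty => simpa using UniformBeurling.const s 1
  | insert a S ha ih =>
    simp only [Finset.prod_insert ha]
    exact (hg a (Finset.mem_insert_self _ _)).mul hs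
      (ih fun i hi => hg i (Finset.mem_insert_of_mem hi))

theorem UniformBeurling.comp_affine {s : ℝ} {g : F → ℂ} (hg : UniformBeurling s g)
    (L : E →L[ℝ] F) (b : F) : UniformBeurling s (fun x => g (b + L x)) := by
  have hc : ContDiff ℝ (⊤ : ℕ∞) (fun y => g (b + y)) := hg.1.comp (contDiff_const.add contDiff_id)
  refine ⟨hc.comp L.contDiff, fun B hB => ?_⟩
  -- The chain rule costs `‖L‖ ^ n`; the added `1` keeps the quotient meaningful for `L = 0`.
  obtain ⟨M, hM, h1⟩ := hg.2 (B / (‖L‖ + 1)) (by positivity)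
  refine ⟨M, hM, fun n x => ?_⟩
  have h2 : ‖iteratedFDeriv ℝ n (fun y => g (b + y)) (L x)‖ ≤
      M * (n.factorial : ℝ) ^ s * (B / (‖L‖ + 1)) ^ n := by
    rw [iteratedFDeriv_comp_add_left]
    exact h1 n _
  have h3 := ContinuousLinearMap.iteratedFDeriv_comp_right L hc x (i := n)
    (by exact_mod_cast le_top)
  change ‖iteratedFDeriv ℝ n ((fun y => g (b + y)) ∘ L) x‖ ≤ _
  rw [h3]
  refine (ContinuousMultilinearMap.norm_compContinuousLinearMap_le _ _).trans ?_
  rw [Finset.prod_const, Finset.card_univ, Fintype.card_fin]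
  calc _ ≤ M * (n.factorial : ℝ) ^ s * (B / (‖L‖ + 1)) ^ n * (‖L‖ + 1) ^ n := by
        gcongr
        linarith
    _ = M * (n.factorial : ℝ) ^ s * B ^ n := by
        rw [mul_assoc, ← mul_pow, div_mul_cancel₀ _ (by positivity)]
end

/-! ### Gevrey cut-off functions -/

/-- Any positive power of `n!` beats any geometric sequence: raise `r ^ n ≤ exp r * n!` to the power
`δ = s - σ`, with `r ^ δ = C / B`. Thus Gevrey bounds of a smaller order, even with one fixed
constant, give Beurling bounds of order `s`. -/
theorem factorial_gap {σ s : ℝ} (h : σ < s) {C B : ℝ} (hC : 0 < C) (hB : 0 < B) :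
    ∃ M : ℝ, 0 ≤ M ∧ ∀ n : ℕ, (n.factorial : ℝ) ^ σ * C ^ n ≤ M * (n.factorial : ℝ) ^ s * B ^ n := by
  set δ := s - σ with hδ
  have hδ0 : 0 < δ := by linarith
  set r := (C / B) ^ (1 / δ)
  have hr : 0 ≤ r := by positivity
  refine ⟨Real.exp r ^ δ, by positivity, fun n => ?_⟩
  have h1 := Real.pow_div_factorial_le_exp _ hr n
  have hf : (0 : ℝ) < n.factorial := by positivity
  rw [div_le_iff₀ hf] at h1
  have h2 := Real.rpow_le_rpow (by positivity) h1 hδ0.le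
  have hrδ : r ^ δ = C / B := by
    rw [← Real.rpow_mul (by positivity), one_div_mul_cancel hδ0.ne', Real.rpow_one]
  rw [Real.mul_rpow (by positivity) (by positivity), ← Real.rpow_natCast, ← Real.rpow_mul hr,
    mul_comm (n : ℝ), Real.rpow_mul hr, hrδ, Real.rpow_natCast, div_pow,
    div_le_iff₀ (by positivity)] at h2
  have h3 : (n.factorial : ℝ) ^ s = (n.factorial : ℝ) ^ σ * (n.factorial : ℝ) ^ δ := by
    rw [← Real.rpow_add hf]; congr 1; ring
  rw [h3]
  calc (n.factorial : ℝ) ^ σ * C ^ n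
      ≤ (n.factorial : ℝ) ^ σ * (Real.exp r ^ δ * (n.factorial : ℝ) ^ δ * B ^ n) := by gcongr
    _ = _ := by ring

/-- `exp (-1 / x ^ m)` for `x > 0`, and `0` for `x ≤ 0` (`m` odd). -/
noncomputable def flatPow (m : ℕ) (x : ℝ) : ℝ := expNegInvGlue (x ^ m)

theorem contDiff_flatPow (m : ℕ) : ContDiff ℝ (⊤ : ℕ∞) (flatPow m) :=
  expNegInvGlue.contDiff.comp (contDiff_id.pow m)

/-- Continuity at `w = 1`. By homogeneity it yields, around every `x > 0`, a disc of radius `ε * x`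
on which `Re (z ^ m)⁻¹` is at least half its value at the centre. -/
theorem exists_re_inv_pow_ge (m : ℕ) : ∃ ε : ℝ, 0 < ε ∧ ε < 1 ∧
    ∀ w : ℂ, ‖w - 1‖ ≤ ε → 1 / 2 ≤ ((w ^ m)⁻¹).re := by
  have hc : ContinuousAt (fun w : ℂ => ((w ^ m)⁻¹).re) 1 := by
    refine Complex.continuous_re.continuousAt.comp ?_
    exact (continuousAt_id.pow m).inv₀ (by simp)
  have h1 : ∀ᶠ w : ℂ in 𝓝 1, 1 / 2 < ((w ^ m)⁻¹).re := by
    apply hc.eventually_const_lt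
    norm_num
  obtain ⟨ε, hε, h2⟩ := Metric.eventually_nhds_iff.1 h1
  refine ⟨min (ε / 2) (1 / 2), by positivity, by rw [min_lt_iff]; right; norm_num, fun w hw => ?_⟩
  refine (h2 ?_).le
  rw [dist_eq_norm]
  have := hw.trans (min_le_left _ _)
  linarith

/-- Cauchy's estimate on the disc of radius `ε * x` gives `n! (ε x)^{-n} exp(-x^{-m}/2)`. The
exponential compensates `x^{-n}` uniformly in `x` at the cost of `(n!)^{1/m}`, whence the order `1 +
1/m`. -/
theorem norm_iteratedDeriv_exp_neg_inv_pow_le {m : ℕ} (hm : m ≠ 0) : ∃ C : ℝ, 0 < C ∧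
    ∀ (n : ℕ) (x : ℝ), 0 < x →
      ‖iteratedDeriv n (fun z : ℂ => Complex.exp (-(z ^ m)⁻¹)) x‖ ≤
        (n.factorial : ℝ) ^ (1 + 1 / (m : ℝ)) * C ^ n := by
  obtain ⟨ε, hε, hε1, hre⟩ := exists_re_inv_pow_ge m
  refine ⟨2 / ε, by positivity, fun n x hx => ?_⟩
  have hxc : (x : ℂ) ≠ 0 := by exact_mod_cast hx.ne'
  have hre' : ∀ z : ℂ, ‖z - x‖ ≤ ε * x → 1 / 2 * (x ^ m)⁻¹ ≤ ((z ^ m)⁻¹).re := by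
    intro z hz
    have h1 := hre (z / x) (by
      rw [div_sub_one hxc, norm_div, Complex.norm_real, Real.norm_of_nonneg hx.le,
        div_le_iff₀ hx]
      exact hz)
    have h2 : (z ^ m)⁻¹ = (((z / x) ^ m)⁻¹) * (((x ^ m)⁻¹ : ℝ) : ℂ) := by
      push_cast
      rw [div_pow, inv_div, div_mul_eq_mul_div, mul_inv_cancel₀ (pow_ne_zero _ hxc), one_div]
    rw [h2, Complex.re_mul_ofReal]
    gcongr
  -- At `z = 0` the inverse is `0` by convention, which contradicts the positive lower bound; so the
  -- closed disc misses the singularity.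
  have hz0 : ∀ z : ℂ, ‖z - x‖ ≤ ε * x → z ≠ 0 := by
    rintro z hz rfl
    have := hre' 0 hz
    rw [zero_pow hm] at this
    have h3 : (0 : ℝ) < (x ^ m)⁻¹ := by positivity
    simp only [inv_zero, Complex.zero_re] at this
    linarith
  have hcau := Complex.norm_iteratedDeriv_le_of_forall_mem_sphere_norm_le
    (f := fun z : ℂ => Complex.exp (-(z ^ m)⁻¹)) (c := (x : ℂ)) (R := ε * x)
    (C := Real.exp (-(1 / 2 * (x ^ m)⁻¹))) n (by positivity) (by
      refine DifferentiableOn.diffContOnCl fun z hz => ?_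
      have hz' := Metric.closure_ball_subset_closedBall hz
      rw [Metric.mem_closedBall, dist_eq_norm] at hz'
      have hd : DifferentiableAt ℂ (fun z : ℂ => Complex.exp (-(z ^ m)⁻¹)) z :=
        ((differentiableAt_id.pow m).inv (pow_ne_zero _ (hz0 z hz'))).neg.cexp
      exact hd.differentiableWithinAt) (by
      intro z hz
      rw [mem_sphere_iff_norm] at hz
      rw [Complex.norm_exp]
      apply Real.exp_le_exp.2
      simpa using hre' z hz.le)
  refine hcau.trans ?_
  set u := (x ^ m)⁻¹ with hu
  have hu0 : 0 < u := by positivity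
  have hm0 : (0 : ℝ) < m := by positivity
  have hm1 : (1 : ℝ) ≤ m := by exact_mod_cast Nat.one_le_iff_ne_zero.2 hm
  have hxu : x⁻¹ = u ^ (1 / (m : ℝ)) := by
    rw [hu, ← inv_pow, ← Real.rpow_natCast, ← Real.rpow_mul (by positivity),
      mul_one_div_cancel hm0.ne', Real.rpow_one]
  -- With `u = x^{-m}` the power `x^{-n}` is the `m`-th root of `u ^ n`, and `u ^ n ≤ 2 ^ n * n! *
  -- exp (u / 2)`. Roots of the factors `≥ 1` other than `n!` are bounded by the factors themselves.
  have key : (x⁻¹) ^ n * Real.exp (-(1 / 2 * u)) ≤ (n.factorial : ℝ) ^ (1 / (m : ℝ)) * 2 ^ n := by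
    have h1 := Real.pow_div_factorial_le_exp (u / 2) (by positivity) n
    rw [div_le_iff₀ (by positivity), div_pow, div_le_iff₀ (by positivity)] at h1
    have h2 := Real.rpow_le_rpow (z := 1 / (m : ℝ)) (by positivity) h1 (by positivity)
    have h3 : (u ^ n) ^ (1 / (m : ℝ)) = (x⁻¹) ^ n := by
      rw [hxu, Real.rpow_pow_comm hu0.le]
    rw [h3, Real.mul_rpow (by positivity) (by positivity),
      Real.mul_rpow (by positivity) (by positivity)] at h2
    have h4 : Real.exp (u / 2) ^ (1 / (m : ℝ)) ≤ Real.exp (u / 2) := by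
      apply Real.rpow_le_self_of_one_le
      · exact Real.one_le_exp (by positivity)
      · rw [div_le_one hm0]; exact hm1
    have h5 : ((2 : ℝ) ^ n) ^ (1 / (m : ℝ)) ≤ 2 ^ n := by
      apply Real.rpow_le_self_of_one_le
      · exact one_le_pow₀ (by norm_num)
      · rw [div_le_one hm0]; exact hm1
    calc (x⁻¹) ^ n * Real.exp (-(1 / 2 * u))
        ≤ (Real.exp (u / 2) * (n.factorial : ℝ) ^ (1 / (m : ℝ)) * 2 ^ n) *
            Real.exp (-(1 / 2 * u)) := by
          gcongr
          refine h2.trans ?_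
          gcongr
      _ = (n.factorial : ℝ) ^ (1 / (m : ℝ)) * 2 ^ n *
            (Real.exp (u / 2) * Real.exp (-(1 / 2 * u))) := by ring
      _ = _ := by
          rw [← Real.exp_add, show u / 2 + -(1 / 2 * u) = 0 by ring, Real.exp_zero, mul_one]
  calc (n.factorial : ℝ) * Real.exp (-(1 / 2 * u)) / (ε * x) ^ n
      = n.factorial * ((x⁻¹) ^ n * Real.exp (-(1 / 2 * u))) * (1 / ε) ^ n := by
        rw [mul_pow, inv_pow x, one_div ε, inv_pow, div_eq_mul_inv, mul_inv]; ring
    _ ≤ n.factorial * ((n.factorial : ℝ) ^ (1 / (m : ℝ)) * 2 ^ n) * (1 / ε) ^ n := by gcongr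
    _ = _ := by
        rw [Real.rpow_add (by positivity), Real.rpow_one, div_pow, div_pow, one_pow]
        ring

/-- On the positive axis the function is the restriction of one holomorphic off `0`, so each real
derivative is the restriction of the complex one. This is what makes Cauchy's estimate available. -/
theorem iteratedDeriv_flatPow {m : ℕ} (n : ℕ) {x : ℝ} (hx : 0 < x) :
    iteratedDeriv n (fun x => (flatPow m x : ℂ)) x =
      iteratedDeriv n (fun z : ℂ => Complex.exp (-(z ^ m)⁻¹)) x := by
  have han : ∀ n : ℕ, AnalyticOnNhd ℂ (iteratedDeriv n fun z : ℂ => Complex.exp (-(z ^ m)⁻¹))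
      {0}ᶜ := by
    intro n
    induction n with
    | zero =>
      rw [iteratedDeriv_zero]
      refine DifferentiableOn.analyticOnNhd (fun z hz => ?_) isOpen_compl_singleton
      have hd : DifferentiableAt ℂ (fun z : ℂ => Complex.exp (-(z ^ m)⁻¹)) z :=
        ((differentiableAt_id.pow m).inv (pow_ne_zero _ hz)).neg.cexp
      exact hd.differentiableWithinAt
    | succ n ih =>
      rw [iteratedDeriv_succ]
      exact ih.deriv
  induction n generalizing x with
  | zero =>
    simp only [iteratedDeriv_zero, flatPow, expNegInvGlue]
    rw [if_neg (not_le.2 (by positivity))]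
    push_cast
    rfl
  | succ n ih =>
    rw [iteratedDeriv_succ, iteratedDeriv_succ]
    have hx0 : (x : ℂ) ∈ ({0}ᶜ : Set ℂ) := by simpa using hx.ne'
    have h1 := ((han n x hx0).differentiableAt.hasDerivAt).comp_ofReal
    refine (h1.congr_of_eventuallyEq ?_).deriv
    filter_upwards [Ioi_mem_nhds hx] with y hy using ih hy

/-- For `x > 0` combine the Cauchy bounds with `factorial_gap`; for `x < 0` the function vanishes
because `m` is odd. The point `0` follows since the bound is a closed condition valid on a dense
set. -/
theorem uniformBeurling_flatPow {s : ℝ} {m : ℕ} (hm : Odd m) (hms : 1 + 1 / (m : ℝ) < s) :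
    UniformBeurling s (fun x => (flatPow m x : ℂ)) := by
  have hsm : ContDiff ℝ (⊤ : ℕ∞) (fun x => (flatPow m x : ℂ)) :=
    Complex.ofRealCLM.contDiff.comp (contDiff_flatPow m)
  refine ⟨hsm, fun B hB => ?_⟩
  obtain ⟨C, hC, h1⟩ := norm_iteratedDeriv_exp_neg_inv_pow_le hm.pos.ne'
  obtain ⟨M, hM, h2⟩ := factorial_gap hms hC hB
  refine ⟨M, hM, fun n => ?_⟩
  have hcl : IsClosed {x | ‖iteratedFDeriv ℝ n (fun x => (flatPow m x : ℂ)) x‖ ≤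
      M * (n.factorial : ℝ) ^ s * B ^ n} :=
    isClosed_le (hsm.continuous_iteratedFDeriv (by exact_mod_cast le_top)).norm continuous_const
  have hsub : ({0}ᶜ : Set ℝ) ⊆ {x | ‖iteratedFDeriv ℝ n (fun x => (flatPow m x : ℂ)) x‖ ≤
      M * (n.factorial : ℝ) ^ s * B ^ n} := by
    intro x hx
    rw [mem_ofPred_eq, norm_iteratedFDeriv_eq_norm_iteratedDeriv]
    rcases lt_or_gt_of_ne hx with h | h
    · have h0 : (fun x => (flatPow m x : ℂ)) =ᶠ[𝓝 x] fun _ => 0 := by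
        filter_upwards [Iio_mem_nhds h] with y hy
        rw [flatPow, expNegInvGlue.zero_of_nonpos (hm.pow_nonpos (le_of_lt hy))]
        simp
      rw [h0.iteratedDeriv_eq]
      simp only [iteratedDeriv_const]
      split_ifs <;> simp <;> positivity
    · rw [iteratedDeriv_flatPow n h]
      exact (h1 n x h).trans (h2 n)
  intro x
  have := hcl.closure_subset_iff.2 hsub
  rw [dense_compl_singleton (0 : ℝ) |>.closure_eq] at this
  exact this (mem_univ x)

/-- An odd `m` with `1 + 1/m < s` is chosen, and a function flat at `0` is multiplied by its
reflection, which is flat at `1`. -/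
theorem exists_bump {s : ℝ} (hs : 1 < s) : ∃ h : ℝ → ℝ, UniformBeurling s (fun x => (h x : ℂ)) ∧
    (∀ x, x ≤ 0 → h x = 0) ∧ (∀ x, 1 ≤ x → h x = 0) ∧ ∀ x, 0 < x → x < 1 → 0 < h x := by
  obtain ⟨k, hk⟩ := exists_nat_gt (1 / (s - 1))
  set m := 2 * k + 1 with hm
  have hodd : Odd m := ⟨k, rfl⟩
  have hms : 1 + 1 / (m : ℝ) < s := by
    have h1 : 1 / (s - 1) < m := by rw [hm]; push_cast; linarith [Nat.cast_nonneg (α := ℝ) k]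
    have h2 : 0 < s - 1 := by linarith
    have h3 : 1 / (m : ℝ) < s - 1 := (one_div_lt h2 (by positivity)).1 h1
    linarith
  have hb := uniformBeurling_flatPow hodd hms
  have hb2 := hb.comp_affine (-(ContinuousLinearMap.id ℝ ℝ)) 1
  refine ⟨fun x => flatPow m x * flatPow m (1 - x), ?_, fun x hx => ?_, fun x hx => ?_,
    fun x h0 h1 => ?_⟩
  · have := hb.mul (by linarith) hb2
    simpa [← sub_eq_add_neg] using this
  · simp [flatPow, expNegInvGlue.zero_of_nonpos (hodd.pow_nonpos hx)]
  · have : 1 - x ≤ 0 := by linarith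
    simp [flatPow, expNegInvGlue.zero_of_nonpos (hodd.pow_nonpos this)]
  · exact mul_pos (expNegInvGlue.pos_of_pos (pow_pos h0 _))
      (expNegInvGlue.pos_of_pos (pow_pos (by linarith) _))

/-- A Gevrey smooth step, which is exactly constant outside `[0, 1]`. -/
theorem exists_step {s : ℝ} (hs : 1 < s) : ∃ θ : ℝ → ℂ, UniformBeurling s θ ∧
    (∀ x, x ≤ 0 → θ x = 0) ∧ ∀ x, 1 ≤ x → θ x = 1 := by
  obtain ⟨h, hb, h0, h1, hpos⟩ := exists_bump hs
  have hcont : Continuous (fun x => (h x : ℂ)) := hb.1.continuous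
  have hcr : Continuous h := Complex.continuous_re.comp hcont
  have hint : ∀ a b : ℝ, IntervalIntegrable (fun x => (h x : ℂ)) MeasureTheory.volume a b :=
    fun a b => hcont.intervalIntegrable a b
  set c : ℂ := ∫ t in (0 : ℝ)..1, (h t : ℂ) with hc
  have hc0 : c ≠ 0 := by
    rw [hc, intervalIntegral.integral_ofReal]
    have := intervalIntegral.intervalIntegral_pos_of_pos_on (hcr.intervalIntegrable 0 1)
      (fun x hx => hpos x hx.1 hx.2) one_pos
    exact_mod_cast this.ne'
  have hb' : UniformBeurling s (fun x => c⁻¹ * (h x : ℂ)) :=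
    (UniformBeurling.const s c⁻¹).mul (by linarith) hb
  set θ : ℝ → ℂ := fun x => c⁻¹ * ∫ t in (0 : ℝ)..x, (h t : ℂ) with hθ
  have hd : ∀ x, HasDerivAt θ (c⁻¹ * (h x : ℂ)) x := fun x =>
    (intervalIntegral.integral_hasDerivAt_right (hint 0 x)
      (hcont.stronglyMeasurableAtFilter _ _) hcont.continuousAt).const_mul _
  have hderiv : deriv θ = fun x => c⁻¹ * (h x : ℂ) := funext fun x => (hd x).deriv
  have hz : ∀ x, x ≤ 0 → θ x = 0 := by
    intro x hx
    have : ∫ t in (0 : ℝ)..x, (h t : ℂ) = ∫ t in (0 : ℝ)..x, (0 : ℂ) := by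
      refine intervalIntegral.integral_congr fun t ht => ?_
      rw [uIcc_of_ge hx] at ht
      simp [h0 t ht.2]
    simp [hθ, this]
  have ho : ∀ x, 1 ≤ x → θ x = 1 := by
    intro x hx
    have : ∫ t in (1 : ℝ)..x, (h t : ℂ) = ∫ t in (1 : ℝ)..x, (0 : ℂ) := by
      refine intervalIntegral.integral_congr fun t ht => ?_
      rw [uIcc_of_le hx] at ht
      simp [h1 t ht.1]
    simp only [hθ]
    rw [← intervalIntegral.integral_add_adjacent_intervals (hint 0 1) (hint 1 x), this]
    simp [← hc, hc0]
  refine ⟨θ, ⟨?_, fun B hB => ?_⟩, hz, ho⟩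
  · rw [show ((⊤ : ℕ∞) : WithTop ℕ∞) = (⊤ : ℕ∞) + 1 from rfl, contDiff_succ_iff_deriv]
    refine ⟨fun x => (hd x).differentiableAt, by simp, ?_⟩
    rw [hderiv]
    exact hb'.1
  · obtain ⟨M, hM, hn⟩ := hb'.2 B hB
    have hθc : Continuous θ := continuous_iff_continuousAt.2 fun x => (hd x).continuousAt
    obtain ⟨N, hN⟩ := (isCompact_Icc (a := (0 : ℝ)) (b := 1)).exists_bound_of_continuousOn
      hθc.continuousOn
    have hN0 : 0 ≤ N := (norm_nonneg _).trans (hN 0 (by simp))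
    have hbd : ∀ x, ‖θ x‖ ≤ N := by
      intro x
      by_cases hx0 : x ≤ 0
      · rw [hz x hx0, norm_zero]; exact hN0
      by_cases hx1 : 1 ≤ x
      · rw [ho x hx1, ← ho 1 le_rfl]; exact hN 1 (by simp)
      · exact hN x ⟨by linarith, by linarith⟩
    -- `N` covers order zero. A derivative of order `n + 1` is one of order `n` of the normalized
    -- bump, and the missing factor `B` turns `M` into `M / B`.
    refine ⟨max N (M / B), le_max_of_le_left hN0, fun n x => ?_⟩
    rcases n with _ | n
    · simpa using Or.inl (hbd x)
    · rw [norm_iteratedFDeriv_eq_norm_iteratedDeriv, iteratedDeriv_succ', hderiv,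
        ← norm_iteratedFDeriv_eq_norm_iteratedDeriv]
      have hf : (n.factorial : ℝ) ≤ (n + 1).factorial := by
        exact_mod_cast Nat.factorial_le (Nat.le_succ n)
      calc _ ≤ M * (n.factorial : ℝ) ^ s * B ^ n := hn n x
        _ = (M / B) * (n.factorial : ℝ) ^ s * B ^ (n + 1) := by rw [pow_succ]; field_simp
        _ ≤ _ := by
            gcongr
            · exact le_max_right _ _

/-- A product of one-dimensional steps in the coordinates: it is `1` on the cube of half-side `r`
about `a` and `0` off the cube of half-side `2 * r = ρ`. -/
theorem exists_cutoff_nhds {d : ℕ} {s : ℝ} (hs : 1 < s) {V : Set (Rd d)} (hV : IsOpen V) {a : Rd d}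
    (ha : a ∈ V) : ∃ χ : Rd d → ℂ, UniformBeurling s χ ∧ HasCompactSupport χ ∧ tsupport χ ⊆ V ∧
      ∀ᶠ x in 𝓝 a, χ x = 1 := by
  obtain ⟨θ, hθ, h0, h1⟩ := exists_step hs
  have hc : Continuous fun y : Fin d → ℝ => (WithLp.toLp 2 y : Rd d) :=
    PiLp.continuous_toLp 2 _
  have hc' : Continuous fun x : Rd d => (WithLp.ofLp x : Fin d → ℝ) := PiLp.continuous_ofLp 2 _
  obtain ⟨ρ, hρ, hsub⟩ := Metric.nhds_basis_closedBall.mem_iff.1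
    ((hV.preimage hc).mem_nhds (show WithLp.ofLp a ∈ _ from ha))
  set r := ρ / 2 with hr
  have hr0 : 0 < r := by positivity
  let p : Fin d → (Rd d →L[ℝ] ℝ) := fun i => EuclideanSpace.proj i
  let χ : Rd d → ℂ := fun x => ∏ i, (θ ((2 - a i / r) + (r⁻¹ • p i) x) *
    θ ((2 + a i / r) + (-(r⁻¹ • p i)) x))
  have hl : ∀ (i : Fin d) (x : Rd d), (2 - a i / r) + (r⁻¹ • p i) x = 2 + (x i - a i) / r := by
    intro i x
    rw [show (r⁻¹ • p i) x = r⁻¹ * x i from rfl]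
    ring
  have hl' : ∀ (i : Fin d) (x : Rd d), (2 + a i / r) + (-(r⁻¹ • p i)) x = 2 - (x i - a i) / r := by
    intro i x
    rw [show (-(r⁻¹ • p i)) x = -(r⁻¹ * x i) from rfl]
    ring
  have hχ : UniformBeurling s χ := UniformBeurling.prod (by linarith) _ fun i _ =>
    (hθ.comp_affine _ _).mul (by linarith) (hθ.comp_affine _ _)
  set Q : Set (Rd d) := (fun y : Fin d → ℝ => (WithLp.toLp 2 y : Rd d)) ''
    Metric.closedBall (WithLp.ofLp a) ρ with hQ
  have hQc : IsCompact Q := (isCompact_closedBall _ _).image hc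
  have hsupp : Function.support χ ⊆ Q := by
    intro x hx
    refine ⟨WithLp.ofLp x, ?_, rfl⟩
    rw [Metric.mem_closedBall, dist_pi_le_iff hρ.le]
    intro i
    have hi := Finset.prod_ne_zero_iff.1 hx i (Finset.mem_univ i)
    rw [hl, hl'] at hi
    rw [Real.dist_eq, abs_le]
    have e : ρ = 2 * r := by rw [hr]; ring
    constructor
    · by_contra hcon
      refine hi (mul_eq_zero_of_left (h0 _ ?_) _)
      have : (x i - a i) / r ≤ -2 := by rw [div_le_iff₀ hr0]; linarith
      linarith
    · by_contra hcon
      refine hi (mul_eq_zero_of_right _ (h0 _ ?_))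
      have : 2 ≤ (x i - a i) / r := by rw [le_div_iff₀ hr0]; linarith
      linarith
  have hts : tsupport χ ⊆ Q := closure_minimal hsupp hQc.isClosed
  refine ⟨χ, hχ, hQc.of_isClosed_subset (isClosed_tsupport _) hts, hts.trans ?_, ?_⟩
  · rintro _ ⟨y, hy, rfl⟩
    exact hsub hy
  · have : ∀ᶠ x : Rd d in 𝓝 a, WithLp.ofLp x ∈ Metric.closedBall (WithLp.ofLp a) r :=
      hc'.continuousAt.eventually (Metric.closedBall_mem_nhds _ hr0)
    filter_upwards [this] with x hx
    rw [Metric.mem_closedBall, dist_pi_le_iff hr0.le] at hx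
    refine Finset.prod_eq_one fun i _ => ?_
    have hi := hx i
    rw [Real.dist_eq, abs_le] at hi
    rw [hl, hl', h1, h1, one_mul]
    · have : (x i - a i) / r ≤ 1 := by rw [div_le_iff₀ hr0]; linarith
      linarith
    · have : -1 ≤ (x i - a i) / r := by rw [le_div_iff₀ hr0]; linarith
      linarith

/-- Gevrey cut-off functions for a compact subset of an open set. -/
theorem exists_cutoff {d : ℕ} {s : ℝ} (hs : 1 < s) {V K : Set (Rd d)} (hV : IsOpen V)
    (hK : IsCompact K) (hKV : K ⊆ V) : ∃ χ : Rd d → ℂ, UniformBeurling s χ ∧ HasCompactSupport χ ∧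
      tsupport χ ⊆ V ∧ ∀ᶠ x in 𝓝ˢ K, χ x = 1 := by
  refine hK.induction_on (p := fun K => ∃ χ : Rd d → ℂ, UniformBeurling s χ ∧ HasCompactSupport χ ∧
      tsupport χ ⊆ V ∧ ∀ᶠ x in 𝓝ˢ K, χ x = 1) ?_ ?_ ?_ ?_
  · refine ⟨fun _ => 0, UniformBeurling.const s 0, HasCompactSupport.zero, ?_, by simp⟩
    simp [tsupport, Function.support]
  · rintro S T hST ⟨χ, h1, h2, h3, h4⟩
    exact ⟨χ, h1, h2, h3, h4.filter_mono (nhdsSet_mono hST)⟩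
  · rintro S T ⟨χ, h1, h2, h3, h4⟩ ⟨χ', h1', h2', h3', h4'⟩
    -- The combination is `1 - (1 - χ)(1 - χ')`, which equals `1` wherever one of the two cut-offs
    -- does.
    have hts : tsupport (fun x => χ x + χ' x - χ x * χ' x) ⊆ tsupport χ ∪ tsupport χ' := by
      refine closure_minimal (fun x hx => ?_)
        ((isClosed_tsupport _).union (isClosed_tsupport _))
      by_contra hcon
      rw [mem_union, not_or] at hcon
      have e1 := image_eq_zero_of_notMem_tsupport hcon.1
      have e2 := image_eq_zero_of_notMem_tsupport hcon.2
      exact hx (by simp [e1, e2])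
    refine ⟨fun x => χ x + χ' x - χ x * χ' x,
      (h1.add h1').sub (by linarith) (h1.mul (by linarith) h1'),
      (h2.isCompact.union h2'.isCompact).of_isClosed_subset (isClosed_tsupport _) hts,
      hts.trans (union_subset h3 h3'), ?_⟩
    rw [nhdsSet_union, eventually_sup]
    refine ⟨?_, ?_⟩
    · filter_upwards [h4] with x hx
      rw [hx]; ring
    · filter_upwards [h4'] with x hx
      rw [hx]; ring
  · intro a ha
    obtain ⟨χ, h1, h2, h3, h4⟩ := exists_cutoff_nhds hs hV (hKV ha)
    obtain ⟨t, ht, hto, hat⟩ := eventually_nhds_iff.1 h4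
    exact ⟨t, mem_nhdsWithin_of_mem_nhds (hto.mem_nhds hat), χ, h1, h2, h3,
      Filter.mem_of_superset hto.mem_nhdsSet_self ht⟩

/-! ### Global bounds versus Gevrey norms, and continuity of functionals -/

theorem UniformBeurling.gevreyNorm_lt_top {d : ℕ} {s : ℝ} (hs : 1 < s) {g : Rd d → ℂ}
    (hg : UniformBeurling s g) : ∃ A : ℝ, 0 < A ∧ ∀ K : Set (Rd d), gevreyNorm s A K g < ∞ := by
  obtain ⟨M, hM, h⟩ := hg.2 1 one_pos
  obtain ⟨A, hA, hAB⟩ := exists_radius d s 1 zero_le_one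
  exact ⟨A, hA, fun K => (gevreyNorm_le_of_norm_le (by linarith) hA.le zero_le_one hM hAB
    fun n x _ => h n x).trans_lt ENNReal.ofReal_lt_top⟩

theorem UniformBeurling.mem_roumieu {d : ℕ} {s : ℝ} (hs : 1 < s) {g : Rd d → ℂ}
    (hg : UniformBeurling s g) : g ∈ roumieuSubmodule d s := by
  obtain ⟨A, hA, h⟩ := hg.gevreyNorm_lt_top hs
  exact (Submodule.mem_iInf _).2 fun K => ⟨hg.1, A, hA, h K⟩

/-- Passing from partial derivatives to the full derivative costs `d ^ n`, so the radius `(d + 1) /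
B` gives the rate `B` (with `d + 1` in place of `d` to stay positive). Off `K` all derivatives
vanish. -/
theorem uniformBeurling_of_mem_beurlingTest {d : ℕ} {s : ℝ} (hs : 1 < s) {X : Set (Rd d)}
    {φ : Rd d → ℂ} (h : φ ∈ beurlingTest s X) : UniformBeurling s φ := by
  obtain ⟨hφ, K, -, -, hK, hA⟩ := h
  refine ⟨hφ, fun B hB => ?_⟩
  have hA0 : 0 < ((d : ℝ) + 1) / B := by positivity
  refine ⟨(gevreyNorm s (((d : ℝ) + 1) / B) K φ).toReal, ENNReal.toReal_nonneg, fun n x => ?_⟩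
  by_cases hx : x ∈ K
  · refine (norm_le_of_gevreyNorm_le (by linarith) hA0 hφ ENNReal.toReal_nonneg
      (ENNReal.ofReal_toReal (hA _ hA0).ne).ge n hx).trans ?_
    gcongr
    rw [div_div_eq_mul_div, div_le_iff₀ (by positivity)]
    nlinarith
  · have h0 : iteratedFDeriv ℝ n φ x = 0 := by
      by_contra hne
      exact hx (hK (support_iteratedFDeriv_subset _ hne))
    rw [h0, norm_zero]
    positivity

/-- A continuous functional is bounded by the Gevrey norms on one compact set. -/
theorem exists_gevreyNorm_bound {d : ℕ} {s : ℝ} (f : CompactUltradistribution d s) :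
    ∃ K : TopologicalSpace.Compacts (Rd d), ∀ A : ℝ, 0 < A → ∃ C : ℝ≥0, ∀ φ : RoumieuSpace d s,
      ENNReal.ofReal ‖f φ‖ ≤ C * gevreyNorm s A K φ.fn := by
  classical
  have hw0 : ∀ K : TopologicalSpace.Compacts (Rd d), WithSeminorms (inductiveFamily d s K) :=
    fun K => ⟨rfl⟩
  have hw : WithSeminorms (SeminormFamily.sigma fun K : TopologicalSpace.Compacts (Rd d) =>
      (inductiveFamily d s K).comp (toGevreyOn K)) :=
    withSeminorms_iInf (𝕜 := ℂ) (E := RoumieuSpace d s)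
      (t := fun K => TopologicalSpace.induced (toGevreyOn (s := s) K) inferInstance)
      fun K => (toGevreyOn (s := s) K).withSeminorms_induced (hw0 K)
  have hq : Continuous ((normSeminorm ℂ ℂ).comp (f : RoumieuSpace d s →ₗ[ℂ] ℂ)) :=
    continuous_norm.comp f.continuous
  obtain ⟨S, C, -, hC⟩ := Seminorm.bound_of_continuous hw _ hq
  -- Finitely many defining seminorms bound `f`, each attached to one compact set. Their union does
  -- not depend on `A`, because an inductive seminorm is controlled at every radius; only the
  -- constant `c` does.
  refine ⟨⟨⋃ i ∈ S, (i.1 : Set (Rd d)), S.isCompact_biUnion fun i _ => i.1.isCompact⟩,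
    fun A hA => ?_⟩
  choose c hc using fun i : (Σ K : TopologicalSpace.Compacts (Rd d),
    {p : Seminorm ℂ (GevreyOn d s K) // IsInductiveSeminorm p}) => i.2.2 A hA
  refine ⟨C * ∑ i ∈ S, c i, fun φ => ?_⟩
  have h1 : ‖f φ‖ ≤ C * ∑ i ∈ S, i.2.1 (toGevreyOn i.1 φ) := by
    refine (hC φ).trans ?_
    rw [smul_apply, NNReal.smul_def, smul_eq_mul]
    refine mul_le_mul_of_nonneg_left ?_ C.coe_nonneg
    refine Seminorm.finset_sup_apply_le (Finset.sum_nonneg fun i _ => apply_nonneg _ _)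
      fun i hi => ?_
    exact Finset.single_le_sum (f := fun i : (Σ K : TopologicalSpace.Compacts (Rd d),
      {p : Seminorm ℂ (GevreyOn d s K) // IsInductiveSeminorm p}) => i.2.1 (toGevreyOn i.1 φ))
      (fun i _ => apply_nonneg _ _) hi
  refine (ENNReal.ofReal_le_ofReal h1).trans ?_
  rw [ENNReal.ofReal_mul C.coe_nonneg, ENNReal.ofReal_coe_nnreal,
    ENNReal.ofReal_sum_of_nonneg fun i _ => apply_nonneg _ _]
  push_cast
  rw [mul_assoc, Finset.sum_mul]
  gcongr with i hi
  refine (hc i _).trans ?_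
  gcongr
  refine iSup_mono fun β => iSup₂_le fun x hx => ?_
  exact le_iSup₂ (f := fun x (_ : x ∈ ⋃ i ∈ S, (i.1 : Set (Rd d))) => ENNReal.ofReal
    (A ^ (∑ i, β i) / (multiFactorial β : ℝ) ^ s * ‖multiDeriv β φ.fn x‖)) x
    (mem_iUnion₂.2 ⟨i, hi, hx⟩)

/-! ### Locality: functionals and their supports -/

theorem gevreyNorm_eq_zero {d : ℕ} {s A : ℝ} {K : Set (Rd d)} {g : Rd d → ℂ}
    (h : ∀ᶠ x in 𝓝ˢ K, g x = 0) : gevreyNorm s A K g = 0 := by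
  refine le_antisymm (iSup_le fun β => iSup₂_le fun x hx => ?_) bot_le
  have h0 : g =ᶠ[𝓝 x] fun _ => 0 := h.filter_mono (nhds_le_nhdsSet hx)
  have h1 : multiDeriv β g x = 0 := by
    unfold multiDeriv
    rw [(h0.iteratedFDeriv ℝ (∑ i, β i)).eq_of_nhds]
    simp
  simp [h1]

/-- `φ ↦ ⟨f, g φ⟩` for `g` in the Roumieu space. -/
theorem mulUltra_apply {d : ℕ} {s : ℝ} (hs : 1 < s) (g φ : RoumieuSpace d s)
    (f : CompactUltradistribution d s) : mulUltra hs g f φ = f (mulTest hs g φ) := rfl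

theorem mulTest_fn {d : ℕ} {s : ℝ} (hs : 1 < s) (g φ : RoumieuSpace d s) (x : Rd d) :
    (mulTest hs g φ).fn x = g.fn x * φ.fn x := rfl

theorem RoumieuSpace.ext_fn {d : ℕ} {s : ℝ} {φ ψ : RoumieuSpace d s} (h : ∀ x, φ.fn x = ψ.fn x) :
    φ = ψ := Subtype.ext (funext h)

/-- `f` vanishes on test functions supported off the support of `f`, after localization. -/
theorem exists_cutoff_vanishing {d : ℕ} {s : ℝ} (hs : 1 < s) (f : CompactUltradistribution d s)
    {K : Set (Rd d)} (hK : IsCompact K) (hKf : K ⊆ (ultraSupport f)ᶜ) :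
    ∃ χ : RoumieuSpace d s, (∀ᶠ x in 𝓝ˢ K, χ.fn x = 1) ∧
      ∀ g : RoumieuSpace d s, f (mulTest hs χ g) = 0 := by
  refine hK.induction_on (p := fun K => ∃ χ : RoumieuSpace d s, (∀ᶠ x in 𝓝ˢ K, χ.fn x = 1) ∧
      ∀ g : RoumieuSpace d s, f (mulTest hs χ g) = 0) ?_ ?_ ?_ ?_
  · refine ⟨0, by simp, fun g => ?_⟩
    have : mulTest hs 0 g = 0 := RoumieuSpace.ext_fn fun x => zero_mul _
    rw [this, map_zero]
  · rintro S T hST ⟨χ, h1, h2⟩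
    exact ⟨χ, h1.filter_mono (nhdsSet_mono hST), h2⟩
  · rintro S T ⟨χ, h1, h2⟩ ⟨χ', h1', h2'⟩
    have hfn : ∀ x, (χ + χ' - mulTest hs χ χ').fn x = χ.fn x + χ'.fn x - χ.fn x * χ'.fn x :=
      fun x => rfl
    refine ⟨χ + χ' - mulTest hs χ χ', ?_, fun g => ?_⟩
    · rw [nhdsSet_union, eventually_sup]
      constructor
      · filter_upwards [h1] with x hx
        rw [hfn, hx]; ring
      · filter_upwards [h1'] with x hx
        rw [hfn, hx]; ring
    -- Each of the three terms has a factor `χ` or `χ'` on which `f` is known to vanish, so no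
    -- partition of unity is needed.
    · have : mulTest hs (χ + χ' - mulTest hs χ χ') g =
          mulTest hs χ g + mulTest hs χ' g - mulTest hs χ (mulTest hs χ' g) :=
        RoumieuSpace.ext_fn fun x => by
          change (χ.fn x + χ'.fn x - χ.fn x * χ'.fn x) * g.fn x =
            χ.fn x * g.fn x + χ'.fn x * g.fn x - χ.fn x * (χ'.fn x * g.fn x)
          ring
      rw [this, map_sub, map_add, h2, h2', h2]
      simp
  · intro a ha
    have ha' := hKf ha
    rw [ultraSupport, compl_compl] at ha'
    obtain ⟨U, ⟨hU, hfU⟩, haU⟩ := ha'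
    obtain ⟨χ, hχ, hχc, hχU, hχ1⟩ := exists_cutoff_nhds hs hU haU
    obtain ⟨t, ht, hto, hat⟩ := eventually_nhds_iff.1 hχ1
    refine ⟨t, mem_nhdsWithin_of_mem_nhds (hto.mem_nhds hat),
      RoumieuSpace.mk χ (hχ.mem_roumieu hs), Filter.mem_of_superset hto.mem_nhdsSet_self ht,
      fun g => hfU _ ?_ ?_⟩
    · exact hχc.mul_right (f' := g.fn)
    · exact (tsupport_mul_subset_left (f := χ) (g := g.fn)).trans hχU

/-- `⟨f, g⟩ = 0` if `g` vanishes near the support of `f`. -/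
theorem apply_eq_zero_of_eventually {d : ℕ} {s : ℝ} (hs : 1 < s) (f : CompactUltradistribution d s)
    (g : RoumieuSpace d s) (hg : ∀ᶠ x in 𝓝ˢ (ultraSupport f), g.fn x = 0) : f g = 0 := by
  obtain ⟨K, hK⟩ := exists_gevreyNorm_bound f
  obtain ⟨χ, hχ, hχc, -, hχ1⟩ := exists_cutoff hs isOpen_univ K.isCompact (subset_univ _)
  set χ' : RoumieuSpace d s := RoumieuSpace.mk χ (hχ.mem_roumieu hs)
  -- The support of `f` is not assumed compact here, so `g` is first cut off around the compact set
  -- `K` that carries the norms; the discarded part vanishes near `K`.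
  have h1 : f (g - mulTest hs χ' g) = 0 := by
    obtain ⟨C, hC⟩ := hK 1 one_pos
    have h2 := hC (g - mulTest hs χ' g)
    rw [gevreyNorm_eq_zero, mul_zero] at h2
    · simpa using h2
    · filter_upwards [hχ1] with x hx
      change g.fn x - χ x * g.fn x = 0
      rw [hx]; ring
  have h3 : f (mulTest hs χ' g) = 0 := by
    have hsub : tsupport (mulTest hs χ' g).fn ⊆ (ultraSupport f)ᶜ := by
      obtain ⟨W, hWo, hfW, hW⟩ := mem_nhdsSet_iff_exists.1 hg
      have : tsupport (mulTest hs χ' g).fn ⊆ Wᶜ := by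
        refine closure_minimal (fun x hx hxW => ?_) hWo.isClosed_compl
        exact hx (show χ x * g.fn x = 0 by rw [hW hxW, mul_zero])
      exact this.trans (compl_subset_compl.2 hfW)
    have hcs : HasCompactSupport (mulTest hs χ' g).fn := hχc.mul_right (f' := g.fn)
    -- Since `η = 1` on the compact support of `χ' g`, multiplying by `η` changes nothing, while `f`
    -- annihilates every multiple of `η`.
    obtain ⟨η, hη, hη0⟩ := exists_cutoff_vanishing hs f hcs.isCompact hsub
    rw [← hη0 (mulTest hs χ' g)]
    congr 1
    refine RoumieuSpace.ext_fn fun x => ?_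
    rw [mulTest_fn hs η]
    by_cases hx : x ∈ tsupport (mulTest hs χ' g).fn
    · rw [(hη.filter_mono (nhds_le_nhdsSet hx)).self_of_nhds, one_mul]
    · rw [image_eq_zero_of_notMem_tsupport hx, mul_zero]
  rw [map_sub, h3, sub_zero] at h1
  exact h1

/-! ### Exponentials, and series of them, as test functions -/

/-- The exponential as an element of the Roumieu space. -/
noncomputable def expTest {d : ℕ} {s : ℝ} (hs : 1 < s) (ξ : Rd d) : RoumieuSpace d s :=
  RoumieuSpace.mk (expFun ξ) (expFun_mem hs ξ)

/-- The `s`-th power of `t ^ n ≤ exp t * n!` at `t = r ^ (1 / s)`. It bounds the derivatives of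
exponentials and also turns Gevrey exponentials into inverse powers for lattice sums. -/
theorem pow_le_exp_rpow_mul_factorial {s : ℝ} (hs : 1 < s) {r : ℝ} (hr : 0 ≤ r) (n : ℕ) :
    r ^ n ≤ Real.exp (s * r ^ (1 / s)) * (n.factorial : ℝ) ^ s := by
  have hs0 : 0 < s := by linarith
  have h1 := Real.pow_div_factorial_le_exp (r ^ (1 / s)) (by positivity) n
  rw [div_le_iff₀ (by positivity)] at h1
  have h2 := Real.rpow_le_rpow (by positivity) h1 hs0.le
  rw [Real.mul_rpow (by positivity) (by positivity), ← Real.exp_mul, ← Real.rpow_pow_comm (by positivity),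
    ← Real.rpow_mul hr, one_div_mul_cancel hs0.ne', Real.rpow_one, mul_comm (r ^ (1 / s))] at h2
  exact h2

theorem norm_iteratedFDeriv_expFun_le_gevrey {d : ℕ} {s : ℝ} (hs : 1 < s) (ξ : Rd d) (n : ℕ)
    (x : Rd d) : ‖iteratedFDeriv ℝ n (expFun ξ) x‖ ≤
      Real.exp (s * ‖ξ‖ ^ (1 / s)) * (n.factorial : ℝ) ^ s :=
  (norm_iteratedFDeriv_expFun_le ξ n x).trans
    (pow_le_exp_rpow_mul_factorial hs (norm_nonneg ξ) n)

/-- A Fourier-type series with Gevrey decay of the coefficients is a smooth function with Gevrey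
bounds. -/
theorem expSeries_bounds {d : ℕ} {s : ℝ} (hs : 1 < s) {ι : Type*} (b : ι → ℂ) (y : ι → Rd d)
    (hb : Summable fun a => ‖b a‖ * Real.exp (s * ‖y a‖ ^ (1 / s))) :
    ContDiff ℝ (⊤ : ℕ∞) (fun x => ∑' a, b a * expFun (y a) x) ∧ ∀ (n : ℕ) (x : Rd d),
      ‖iteratedFDeriv ℝ n (fun x => ∑' a, b a * expFun (y a) x) x‖ ≤
        (∑' a, ‖b a‖ * Real.exp (s * ‖y a‖ ^ (1 / s))) * (n.factorial : ℝ) ^ s := by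
  have hsm : ∀ a, ContDiff ℝ ((⊤ : ℕ∞) : WithTop ℕ∞) (fun x => b a * expFun (y a) x) := fun a =>
    contDiff_const.mul (contDiff_expFun _)
  have hsum : ∀ k : ℕ, (k : ℕ∞) ≤ (⊤ : ℕ∞) → Summable fun a =>
      ‖b a‖ * Real.exp (s * ‖y a‖ ^ (1 / s)) * (k.factorial : ℝ) ^ s :=
    fun k _ => hb.mul_right _
  have hbd : ∀ (k : ℕ) (a : ι) (x : Rd d), (k : ℕ∞) ≤ (⊤ : ℕ∞) →
      ‖iteratedFDeriv ℝ k (fun x => b a * expFun (y a) x) x‖ ≤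
        ‖b a‖ * Real.exp (s * ‖y a‖ ^ (1 / s)) * (k.factorial : ℝ) ^ s := by
    intro k a x _
    change ‖iteratedFDeriv ℝ k (b a • expFun (y a)) x‖ ≤ _
    rw [iteratedFDeriv_const_smul_apply
      ((contDiff_expFun (y a)).of_le (by exact_mod_cast le_top)).contDiffAt, norm_smul, mul_assoc]
    gcongr
    exact norm_iteratedFDeriv_expFun_le_gevrey hs _ _ _
  refine ⟨contDiff_tsum hsm hsum hbd, fun n x => ?_⟩
  rw [iteratedFDeriv_tsum_apply hsm hsum hbd le_top x, ← tsum_mul_right]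
  exact tsum_of_norm_bounded (hsum n le_top).hasSum fun a => hbd n a x le_top

/-- The radius `A` is chosen before the series and its index type, so the same norm controls all
tails of a given series. -/
theorem expSeries_gevreyNorm {d : ℕ} {s : ℝ} (hs : 1 < s) : ∃ A : ℝ, 0 < A ∧
    ∀ {ι : Type} (b : ι → ℂ) (y : ι → Rd d)
      (_ : Summable fun a => ‖b a‖ * Real.exp (s * ‖y a‖ ^ (1 / s))) (K : Set (Rd d)),
      gevreyNorm s A K (fun x => ∑' a, b a * expFun (y a) x) ≤
        ENNReal.ofReal (∑' a, ‖b a‖ * Real.exp (s * ‖y a‖ ^ (1 / s))) := by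
  obtain ⟨A, hA, hAB⟩ := exists_radius d s 1 zero_le_one
  refine ⟨A, hA, fun b y hb K => gevreyNorm_le_of_norm_le (by linarith) hA.le zero_le_one
    (tsum_nonneg fun a => by positivity) hAB fun n x _ => ?_⟩
  rw [one_pow, mul_one]
  exact (expSeries_bounds hs b y hb).2 n x

theorem expSeries_mem {d : ℕ} {s : ℝ} (hs : 1 < s) {ι : Type} (b : ι → ℂ) (y : ι → Rd d)
    (hb : Summable fun a => ‖b a‖ * Real.exp (s * ‖y a‖ ^ (1 / s))) :
    (fun x => ∑' a, b a * expFun (y a) x) ∈ roumieuSubmodule d s := by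
  obtain ⟨A, hA, h⟩ := expSeries_gevreyNorm (d := d) hs
  exact (Submodule.mem_iInf _).2 fun K => ⟨(expSeries_bounds hs b y hb).1, A, hA,
    (h b y hb K).trans_lt ENNReal.ofReal_lt_top⟩

theorem summable_expSeries {d : ℕ} {s : ℝ} (hs : 1 < s) {ι : Type} (b : ι → ℂ) (y : ι → Rd d)
    (hb : Summable fun a => ‖b a‖ * Real.exp (s * ‖y a‖ ^ (1 / s))) (x : Rd d) :
    Summable fun a => b a * expFun (y a) x := by
  refine Summable.of_norm_bounded hb fun a => ?_
  have := norm_iteratedFDeriv_expFun_le_gevrey hs (y a) 0 x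
  rw [norm_iteratedFDeriv_zero, Nat.factorial_zero, Nat.cast_one, Real.one_rpow, mul_one] at this
  rw [norm_mul]
  gcongr

/-- `f` may be applied termwise to a Fourier-type series. -/
theorem hasSum_apply_expSeries {d : ℕ} {s : ℝ} (hs : 1 < s) (f : CompactUltradistribution d s)
    {ι : Type} (b : ι → ℂ) (y : ι → Rd d)
    (hb : Summable fun a => ‖b a‖ * Real.exp (s * ‖y a‖ ^ (1 / s))) :
    HasSum (fun a => b a * f (expTest hs (y a))) (f (RoumieuSpace.mk _ (expSeries_mem hs b y hb))) := by
  obtain ⟨K, hK⟩ := exists_gevreyNorm_bound f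
  obtain ⟨A, hA, hbd⟩ := expSeries_gevreyNorm (d := d) hs
  obtain ⟨C, hC⟩ := hK A hA
  set Ψ : RoumieuSpace d s := RoumieuSpace.mk _ (expSeries_mem hs b y hb)
  -- The error of a partial sum is `f` applied to the series over the complement of `S`, and the
  -- Gevrey norm of that tail is at most the tail of the coefficient sum.
  have key : ∀ S : Finset ι, ‖f Ψ - ∑ a ∈ S, b a * f (expTest hs (y a))‖ ≤
      C * ∑' a : {a // a ∉ S}, ‖b a‖ * Real.exp (s * ‖y a‖ ^ (1 / s)) := by
    intro S
    have h1 : f Ψ - ∑ a ∈ S, b a * f (expTest hs (y a)) =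
        f (Ψ - ∑ a ∈ S, b a • expTest hs (y a)) := by
      simp [map_sub, map_sum]
    have h2 : (Ψ - ∑ a ∈ S, b a • expTest hs (y a)).fn =
        fun x => ∑' a : {a // a ∉ S}, b a * expFun (y a) x := by
      funext x
      have h3 := (summable_expSeries hs b y hb x).sum_add_tsum_subtype_compl S
      let ev : RoumieuSpace d s →ₗ[ℂ] ℂ :=
        { toFun := fun φ => φ.fn x
          map_add' := fun _ _ => rfl
          map_smul' := fun _ _ => rfl }
      change ev (Ψ - ∑ a ∈ S, b a • expTest hs (y a)) = _
      rw [map_sub, map_sum]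
      change (∑' a, b a * expFun (y a) x) - ∑ a ∈ S, b a * expFun (y a) x = _
      rw [← h3]
      ring
    have h4 := hC (Ψ - ∑ a ∈ S, b a • expTest hs (y a))
    rw [h2] at h4
    have h5 := h4.trans (mul_le_mul_right (hbd (fun a : {a // a ∉ S} => b a) (fun a => y a)
      (hb.subtype _) K) _)
    rw [← ENNReal.ofReal_coe_nnreal, ← ENNReal.ofReal_mul C.coe_nonneg,
      ENNReal.ofReal_le_ofReal_iff (mul_nonneg C.coe_nonneg
        (tsum_nonneg fun a => by positivity))] at h5
    rw [h1]
    exact h5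
  rw [HasSum, SummationFilter.unconditional_filter, tendsto_iff_norm_sub_tendsto_zero]
  have h0 : Tendsto (fun S : Finset ι => (C : ℝ) * ∑' a : {a // a ∉ S},
      ‖b a‖ * Real.exp (s * ‖y a‖ ^ (1 / s))) atTop (𝓝 0) := by
    have := (tendsto_tsum_compl_atTop_zero
      (fun a => ‖b a‖ * Real.exp (s * ‖y a‖ ^ (1 / s)))).const_mul (C : ℝ)
    simpa using this
  refine squeeze_zero (fun _ => norm_nonneg _) (fun S => ?_) h0
  rw [norm_sub_rev]
  exact key S

/-- A priori growth of the Fourier transform. -/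
theorem exists_norm_ultraFourier_le {d : ℕ} {s : ℝ} (hs : 1 < s) (f : CompactUltradistribution d s) :
    ∃ C : ℝ, 0 ≤ C ∧ ∀ ξ : Rd d, ‖ultraFourier hs f ξ‖ ≤ C * Real.exp (s * ‖ξ‖ ^ (1 / s)) := by
  obtain ⟨K, hK⟩ := exists_gevreyNorm_bound f
  obtain ⟨A, hA, hAB⟩ := exists_radius d s 1 zero_le_one
  obtain ⟨C, hC⟩ := hK A hA
  refine ⟨|(2 * Real.pi) ^ (-(d : ℝ) / 2)| * C, by positivity, fun ξ => ?_⟩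
  have h1 := (hC (expTest hs ξ)).trans (mul_le_mul_right (gevreyNorm_le_of_norm_le
    (by linarith) hA.le zero_le_one (Real.exp_nonneg _) hAB fun n x _ => by
      rw [one_pow, mul_one]
      exact norm_iteratedFDeriv_expFun_le_gevrey hs ξ n x) _)
  rw [← ENNReal.ofReal_coe_nnreal, ← ENNReal.ofReal_mul C.coe_nonneg,
      ENNReal.ofReal_le_ofReal_iff (by positivity)] at h1
  rw [ultraFourier, norm_mul, Complex.norm_real, Real.norm_eq_abs, mul_assoc]
  gcongr
  exact h1

/-! ### Decay of Fourier transforms of Beurling functions -/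

/-- Moment bounds of all orders give Gevrey decay. -/
theorem le_exp_neg_of_pow_mul_le {s : ℝ} (hs : 1 < s) {r β M B : ℝ} (hr : 0 ≤ r) (hβ : 0 ≤ β)
    (hM : 0 ≤ M) (hB : 0 < B)
    (h : ∀ n : ℕ, r ^ n * β ≤ M * (n.factorial : ℝ) ^ s * B ^ n) :
    β ≤ 2 ^ s * M * Real.exp (-(s / 2 * (r / B) ^ (1 / s))) := by
  have hs0 : 0 < s := by linarith
  set u := (r / B) ^ (1 / s) with hu
  have hu0 : 0 ≤ u := by positivity
  have hus : u ^ s = r / B := by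
    rw [hu, ← Real.rpow_mul (by positivity), one_div_mul_cancel hs0.ne', Real.rpow_one]
  set b := β ^ (1 / s) with hb
  set m := M ^ (1 / s) with hm
  have hb0 : 0 ≤ b := by positivity
  have hm0 : 0 ≤ m := by positivity
  have hbs : b ^ s = β := by
    rw [hb, ← Real.rpow_mul hβ, one_div_mul_cancel hs0.ne', Real.rpow_one]
  have hms : m ^ s = M := by
    rw [hm, ← Real.rpow_mul hM, one_div_mul_cancel hs0.ne', Real.rpow_one]
  have h1 : ∀ n : ℕ, u ^ n * b ≤ m * n.factorial := by
    intro n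
    rw [← Real.rpow_le_rpow_iff (by positivity) (by positivity) hs0,
      Real.mul_rpow (by positivity) hb0, Real.mul_rpow hm0 (by positivity), hbs, hms,
      ← Real.rpow_pow_comm hu0, hus, div_pow, div_mul_eq_mul_div, div_le_iff₀ (by positivity)]
    exact h n
  -- Divide `u ^ n * b ≤ m * n!` by `2 ^ n * n!` and sum over `n`: an exponential series on the
  -- left, a geometric one on the right.
  have h2 : Real.exp (u / 2) * b ≤ 2 * m := by
    have e1 : HasSum (fun n : ℕ => (u / 2) ^ n / n.factorial * b) (Real.exp (u / 2) * b) := by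
      refine HasSum.mul_right b ?_
      rw [Real.exp_eq_exp_ℝ]
      exact NormedSpace.expSeries_div_hasSum_exp (u / 2)
    have e2 : HasSum (fun n : ℕ => (1 / 2 : ℝ) ^ n * m) (2 * m) := hasSum_geometric_two.mul_right m
    refine hasSum_le (fun n => ?_) e1 e2
    rw [div_pow, div_pow, one_pow, div_div, div_mul_eq_mul_div, div_mul_eq_mul_div, one_mul,
      div_le_div_iff₀ (by positivity) (by positivity)]
    nlinarith [h1 n, pow_pos (two_pos (α := ℝ)) n]
  have h3 := Real.rpow_le_rpow (by positivity) h2 hs0.le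
  rw [Real.mul_rpow (by positivity) hb0, Real.mul_rpow (by positivity) hm0, hbs, hms,
    ← Real.exp_mul] at h3
  rw [Real.exp_neg, ← div_eq_mul_inv, le_div_iff₀ (Real.exp_pos _), mul_comm]
  rwa [show s / 2 * u = u / 2 * s by ring]

/-- The Fourier transform of a compactly supported Gevrey function of Beurling type decays faster
than `exp (-N |·|^{1/s})` for every `N`. -/
theorem UniformBeurling.exists_norm_fourier_le {d : ℕ} {s : ℝ} (hs : 1 < s) {G : Rd d → ℂ}
    (hG : UniformBeurling s G) (hGc : HasCompactSupport G) {N : ℝ} (hN : 0 < N) :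
    ∃ C : ℝ, 0 ≤ C ∧ ∀ w : Rd d, ‖𝓕 G w‖ ≤ C * Real.exp (-(N * ‖w‖ ^ (1 / s))) := by
  have hs0 : 0 < s := by linarith
  -- Chosen so that the rate `s / 2 * (‖w‖ / B) ^ (1 / s)` produced by the moment bounds is exactly
  -- `N * ‖w‖ ^ (1 / s)`.
  set B : ℝ := (s / (2 * N)) ^ s with hB
  have hB0 : 0 < B := by positivity
  obtain ⟨M, hM, hbd⟩ := hG.2 B hB0
  set V : ℝ := (MeasureTheory.volume : MeasureTheory.Measure (Rd d)).real (tsupport G) with hV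
  have hVfin : (MeasureTheory.volume : MeasureTheory.Measure (Rd d)) (tsupport G) < ∞ :=
    hGc.isCompact.measure_lt_top
  have hsupp : ∀ n : ℕ, Function.support (iteratedFDeriv ℝ n G) ⊆ tsupport G :=
    fun n => support_iteratedFDeriv_subset n
  have hint : ∀ n : ℕ, MeasureTheory.Integrable (iteratedFDeriv ℝ n G) := fun n =>
    (hG.1.continuous_iteratedFDeriv (by exact_mod_cast le_top)).integrable_of_hasCompactSupport
      (hGc.iteratedFDeriv n)
  have hnorm : ∀ n : ℕ, ∫ v, ‖iteratedFDeriv ℝ n G v‖ ≤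
      V * M * (n.factorial : ℝ) ^ s * B ^ n := by
    intro n
    rw [← MeasureTheory.setIntegral_eq_integral_of_forall_compl_eq_zero (s := tsupport G)
      fun x hx => by
        rw [norm_eq_zero]
        by_contra hne
        exact hx (hsupp n hne)]
    refine (Real.le_norm_self _).trans
      ((MeasureTheory.norm_setIntegral_le_of_norm_le_const hVfin fun x _ => ?_).trans
        (le_of_eq (b := M * (n.factorial : ℝ) ^ s * B ^ n * V) rfl) |>.trans (le_of_eq (by ring)))
    rw [norm_norm]
    exact hbd n x
  have hmom : ∀ (w : Rd d) (n : ℕ), ‖w‖ ^ n * ‖𝓕 G w‖ ≤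
      (V * M) * (n.factorial : ℝ) ^ s * B ^ n := by
    intro w n
    by_cases hw : w = 0 ∧ n ≠ 0
    · rw [hw.1, norm_zero, zero_pow hw.2, zero_mul]
      positivity
    have hwn : 0 < ‖w‖ ^ n := by
      rw [not_and_or, not_ne_iff] at hw
      rcases hw with hw | rfl
      · exact pow_pos (norm_pos_iff.2 hw) n
      · simp
    have h1 := congrFun (Real.fourier_iteratedFDeriv (f := G) (N := (⊤ : ℕ∞)) hG.1
      (fun n _ => hint n) (n := n) le_top) w
    have h2 : ‖𝓕 (iteratedFDeriv ℝ n G) w‖ ≤ V * M * (n.factorial : ℝ) ^ s * B ^ n :=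
      (VectorFourier.norm_fourierIntegral_le_integral_norm _ _ _ _ _).trans (hnorm n)
    -- Evaluated at `(w, …, w)`, the transform of the `n`-th derivative has norm `(2π)^n ‖w‖^{2n} ‖𝓕
    -- G w‖`. The operator norm takes back one factor `‖w‖ ^ n`, and `(2π)^n ≥ 1` is dropped.
    have h3 := (ContinuousMultilinearMap.le_opNorm (𝓕 (iteratedFDeriv ℝ n G) w) fun _ => w)
    rw [h1] at h3
    rw [VectorFourier.fourierPowSMulRight_apply] at h3
    have hin : ‖(innerSL ℝ w) w‖ = ‖w‖ ^ 2 := by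
      rw [innerSL_apply_apply, real_inner_self_eq_norm_sq, norm_pow, norm_norm]
    simp only [Finset.prod_const, Finset.card_univ, Fintype.card_fin, norm_smul, norm_pow, norm_neg,
      neg_apply, hin] at h3
    rw [← h1] at h3
    have h4 : (1 : ℝ) ≤ ‖(2 * Real.pi * Complex.I : ℂ)‖ ^ n := by
      apply one_le_pow₀
      simp only [norm_mul, Complex.norm_I, mul_one, Complex.norm_real, Complex.norm_ofNat]
      rw [Real.norm_of_nonneg Real.pi_pos.le]
      linarith [Real.pi_gt_three]
    have h5 : ‖w‖ ^ n * (‖w‖ ^ n * ‖𝓕 G w‖) ≤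
        ‖w‖ ^ n * ((V * M) * (n.factorial : ℝ) ^ s * B ^ n) := by
      calc ‖w‖ ^ n * (‖w‖ ^ n * ‖𝓕 G w‖) = 1 * ((‖w‖ ^ 2) ^ n * ‖𝓕 G w‖) := by ring
        _ ≤ ‖(2 * Real.pi * Complex.I : ℂ)‖ ^ n * ((‖w‖ ^ 2) ^ n * ‖𝓕 G w‖) := by gcongr
        _ ≤ ‖𝓕 (iteratedFDeriv ℝ n G) w‖ * ‖w‖ ^ n := h3
        _ ≤ (V * M * (n.factorial : ℝ) ^ s * B ^ n) * ‖w‖ ^ n := by gcongr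
        _ = _ := by ring
    exact le_of_mul_le_mul_left h5 hwn
  have hVM : 0 ≤ V * M := mul_nonneg MeasureTheory.measureReal_nonneg hM
  refine ⟨2 ^ s * (V * M), by positivity, fun w => ?_⟩
  refine (le_exp_neg_of_pow_mul_le hs (norm_nonneg w) (norm_nonneg _) hVM hB0 (hmom w)).trans
    (le_of_eq ?_)
  have hBs : B ^ (1 / s) = s / (2 * N) := by
    rw [hB, ← Real.rpow_mul (by positivity), mul_one_div_cancel hs0.ne', Real.rpow_one]
  rw [Real.div_rpow (norm_nonneg _) hB0.le, hBs]
  congr 3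
  field_simp

/-! ### Sums over lattices -/

/-- Gevrey exponentials are summable over lattices. -/
theorem summable_exp_neg_lattice {d : ℕ} {s : ℝ} (hs : 1 < s)
    (ε : Module.Basis (Fin d) ℝ (Rd d)) {κ : ℝ} (hκ : 0 < κ) :
    Summable fun a : Fin d → ℤ => Real.exp (-(κ * ‖∑ j, (a j : ℝ) • ε j‖ ^ (1 / s))) := by
  have hs0 : 0 < s := by linarith
  set L := Submodule.span ℤ (range ε)
  -- Any exponent above the rank makes the inverse powers summable over the lattice.
  set k := Module.finrank ℤ L + 1 with hk
  let y : (Fin d → ℤ) → L := fun a => ⟨∑ j, (a j : ℝ) • ε j, Submodule.sum_mem _ fun j _ => by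
    rw [Int.cast_smul_eq_zsmul]
    exact Submodule.smul_mem _ _ (Submodule.subset_span (mem_range_self j))⟩
  have hinj : Function.Injective y := by
    intro a a' h
    have h1 : ∑ j, (a j : ℝ) • ε j = ∑ j, (a' j : ℝ) • ε j := congrArg Subtype.val h
    have h2 := congrArg ε.equivFun h1
    funext j
    have h3 := congrFun h2 j
    have e : ∀ c : Fin d → ℝ, ε.equivFun (∑ j, c j • ε j) = c := fun c => by
      rw [← ε.equivFun_symm_apply, LinearEquiv.apply_symm_apply]
    rw [e fun j => (a j : ℝ), e fun j => (a' j : ℝ)] at h3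
    exact Int.cast_injective (α := ℝ) h3
  have hsum : Summable fun a : Fin d → ℤ => ‖y a‖⁻¹ ^ k :=
    (ZLattice.summable_norm_pow_inv L k (by omega)).comp_injective hinj
  -- The constant of `pow_le_exp_rpow_mul_factorial` at `r = (κ / s) ^ s * ‖y‖`, for which `s * r ^
  -- (1 / s) = κ * ‖y‖ ^ (1 / s)`.
  set C : ℝ := (k.factorial : ℝ) ^ s / ((κ / s) ^ s) ^ k with hC
  refine Summable.of_norm_bounded_eventually (hsum.mul_left C) ?_
  -- The origin must be left out: there the inverse power is `0` by convention, while the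
  -- exponential is `1`.
  have hfin : ({0} : Set (Fin d → ℤ)).Finite := finite_singleton 0
  filter_upwards [hfin.compl_mem_cofinite] with a ha
  have hy : 0 < ‖y a‖ := by
    rw [norm_pos_iff]
    intro h0
    refine ha (hinj (h0.trans ?_))
    ext1
    simp [y]
  rw [Real.norm_of_nonneg (Real.exp_nonneg _)]
  change Real.exp (-(κ * ‖y a‖ ^ (1 / s))) ≤ _
  have h1 := pow_le_exp_rpow_mul_factorial hs (r := (κ / s) ^ s * ‖y a‖) (by positivity) k
  rw [Real.mul_rpow (by positivity) (by positivity), ← Real.rpow_mul (by positivity),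
    mul_one_div_cancel hs0.ne', Real.rpow_one, ← mul_assoc, mul_div_cancel₀ _ hs0.ne',
    mul_pow] at h1
  rw [Real.exp_neg, hC, inv_pow, ← div_eq_mul_inv, div_div, inv_eq_one_div,
    div_le_div_iff₀ (Real.exp_pos _) (by positivity), one_mul, mul_comm ((k.factorial : ℝ) ^ s)]
  exact h1

/-! ### Fourier series of functions supported in the open unit cube -/

section
variable {d : ℕ}

theorem mFourier_coe (n : Fin d → ℤ) (x : Fin d → ℝ) :
    UnitAddTorus.mFourier n (fun i => (x i : UnitAddCircle)) =
      Complex.exp (2 * Real.pi * Complex.I * ∑ i, (n i : ℂ) * x i) := by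
  simp only [UnitAddTorus.mFourier, ContinuousMap.coe_mk, fourier_coe_apply]
  rw [← Complex.exp_sum, Finset.mul_sum]
  congr 1
  refine Finset.sum_congr rfl fun i _ => ?_
  push_cast
  ring

/-- The function on the torus given by the values on the half-open unit cube. -/
noncomputable def torusFold (G : Rd d → ℂ) (y : UnitAddTorus (Fin d)) : ℂ :=
  G (WithLp.toLp 2 fun i => (AddCircle.equivIco 1 0 (y i) : ℝ))

theorem torusFold_coe (G : Rd d → ℂ) (x : Fin d → ℝ) :
    torusFold G (fun i => (x i : UnitAddCircle)) = G (WithLp.toLp 2 fun i => Int.fract (x i)) := by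
  unfold torusFold
  congr 2
  funext i
  rw [AddCircle.coe_equivIco_mk_apply]
  simp

/-- Continuity is checked upstairs, along the quotient map. The fractional part jumps at integers,
but `G` vanishes near the faces of the cube, so the jump is not seen. -/
theorem continuous_torusFold {G : Rd d → ℂ} (hG : Continuous G) (hGc : HasCompactSupport G)
    (hcube : tsupport G ⊆ {x | ∀ i, x i ∈ Ioo (0 : ℝ) 1}) : Continuous (torusFold G) := by
  have hq : IsOpenQuotientMap
      (Pi.map fun (_ : Fin d) (x : ℝ) => (x : UnitAddCircle)) :=
    IsOpenQuotientMap.piMap fun _ => QuotientAddGroup.isOpenQuotientMap_mk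
  rw [hq.isQuotientMap.continuous_iff]
  have he : torusFold G ∘ (Pi.map fun (_ : Fin d) (x : ℝ) => (x : UnitAddCircle)) =
      fun x => G (WithLp.toLp 2 fun i => Int.fract (x i)) := funext fun x => torusFold_coe G x
  rw [he, continuous_iff_continuousAt]
  intro x
  by_cases hx : ∀ i, Int.fract (x i) ≠ 0
  · refine hG.continuousAt.comp ((PiLp.continuous_toLp 2 _).continuousAt.comp ?_)
    refine continuousAt_pi.2 fun i => ?_
    refine ContinuousAt.comp (f := fun x : Fin d → ℝ => x i) (g := (Int.fract : ℝ → ℝ)) ?_ (continuous_apply i).continuousAt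
    refine continuousAt_fract fun h => hx i ?_
    rw [h, Int.fract_intCast]
  · push Not at hx
    obtain ⟨i, hi⟩ := hx
    have hxi : x i = (⌊x i⌋ : ℝ) := by
      have := Int.floor_add_fract (x i)
      rw [hi, add_zero] at this
      exact this.symm
    set S : Set ℝ := (fun v : Rd d => v i) '' tsupport G with hS
    have hcont : Continuous fun v : Rd d => v i := (EuclideanSpace.proj (𝕜 := ℝ) i).continuous
    have hSc : IsClosed S := (hGc.isCompact.image hcont).isClosed
    have hS01 : S ⊆ Ioo 0 1 := by
      rintro _ ⟨v, hv, rfl⟩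
      exact hcube hv i
    -- At an integer the one-sided limits of the fractional part are `1` and `0`; neither belongs to
    -- the closed set `S ⊆ (0, 1)`.
    have hev : ∀ᶠ t in 𝓝 (x i), Int.fract t ∉ S := by
      rw [← nhdsLT_sup_nhdsGE, eventually_sup]
      constructor
      · rw [hxi]
        exact (tendsto_fract_left' ⌊x i⌋).eventually
          (hSc.isOpen_compl.mem_nhds fun h => lt_irrefl _ (hS01 h).2)
      · rw [hxi]
        exact (tendsto_fract_right' ⌊x i⌋).eventually
          (hSc.isOpen_compl.mem_nhds fun h => lt_irrefl _ (hS01 h).1)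
    have hev' : ∀ᶠ y in 𝓝 x, G (WithLp.toLp 2 fun i => Int.fract (y i)) = 0 := by
      filter_upwards [(continuous_apply i).continuousAt.eventually hev] with y hy
      refine image_eq_zero_of_notMem_tsupport fun h => hy ⟨_, h, rfl⟩
    exact (continuousAt_const (y := (0 : ℂ))).congr (hev'.mono fun y hy => hy.symm)

/-- The coefficient is an integral over one period cell; as `G` vanishes outside the cube, this is
the whole Fourier integral. -/
theorem mFourierCoeff_torusFold {G : Rd d → ℂ}
    (hcube : tsupport G ⊆ {x | ∀ i, x i ∈ Ioo (0 : ℝ) 1}) (n : Fin d → ℤ) :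
    UnitAddTorus.mFourierCoeff (torusFold G) n = 𝓕 G (WithLp.toLp 2 fun i => (n i : ℝ)) := by
  have h0 : ∀ v : Rd d, (¬ ∀ i, v i ∈ Ioo (0 : ℝ) 1) → G v = 0 := fun v hv =>
    image_eq_zero_of_notMem_tsupport fun h => hv (hcube h)
  rw [UnitAddTorus.mFourierCoeff_eq_integral _ _ 0, Real.fourier_eq',
    ← (PiLp.volume_preserving_toLp (Fin d)).integral_comp
      (MeasurableEquiv.toLp 2 _).measurableEmbedding]
  refine Eq.trans ?_ (MeasureTheory.setIntegral_eq_integral_of_forall_compl_eq_zero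
      (s := {x : Fin d → ℝ | ∀ i, x i ∈ Ioc ((0 : Fin d → ℝ) i) ((0 : Fin d → ℝ) i + 1)}) ?_)
  · have hms : MeasurableSet
        {x : Fin d → ℝ | ∀ i, x i ∈ Ioc ((0 : Fin d → ℝ) i) ((0 : Fin d → ℝ) i + 1)} := by
      have : {x : Fin d → ℝ | ∀ i, x i ∈ Ioc ((0 : Fin d → ℝ) i) ((0 : Fin d → ℝ) i + 1)} =
          Set.pi univ fun i => Ioc ((0 : Fin d → ℝ) i) ((0 : Fin d → ℝ) i + 1) := by
        ext x; simp
      rw [this]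
      exact MeasurableSet.univ_pi fun i => measurableSet_Ioc
    refine MeasureTheory.setIntegral_congr_fun hms fun x hx => ?_
    dsimp only
    rw [torusFold_coe, mFourier_coe]
    by_cases h1 : ∀ i, x i < 1
    · have hfr : (fun i => Int.fract (x i)) = x := funext fun i =>
        Int.fract_eq_self.2 ⟨(hx i).1.le, h1 i⟩
      rw [hfr]
      congr 2
      rw [PiLp.inner_apply]
      simp only [Pi.neg_apply, Int.cast_neg, RCLike.inner_apply, conj_trivial]
      push_cast
      simp only [Finset.mul_sum, Finset.sum_mul]
      refine Finset.sum_congr rfl fun i _ => ?_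
      ring
    -- On a face `x i = 1` the fractional part is `0`, so folding changes the point, but `G` is zero
    -- at both.
    · push Not at h1
      obtain ⟨i, hi⟩ := h1
      have hxi : x i = 1 := le_antisymm (by simpa using (hx i).2) hi
      rw [h0, h0, smul_zero, smul_zero]
      · exact fun h => by simpa [hxi] using (h i).2
      · exact fun h => by simpa [hxi] using (h i).1
  · intro x hx
    rw [h0, smul_zero]
    refine fun h => hx fun i => ?_
    simpa using ⟨(h i).1, (h i).2.le⟩

/-- Fourier series of a function supported in the open unit cube. -/
theorem hasSum_fourier_cube {G : Rd d → ℂ} (hG : Continuous G) (hGc : HasCompactSupport G)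
    (hcube : tsupport G ⊆ {x | ∀ i, x i ∈ Ioo (0 : ℝ) 1})
    (hsum : Summable fun n : Fin d → ℤ => 𝓕 G (WithLp.toLp 2 fun i => (n i : ℝ)))
    (x : Rd d) (hx : ∀ i, x i ∈ Ico (0 : ℝ) 1) :
    HasSum (fun n : Fin d → ℤ => 𝓕 G (WithLp.toLp 2 fun i => (n i : ℝ)) *
      Complex.exp (2 * Real.pi * Complex.I * ∑ i, (n i : ℂ) * x i)) (G x) := by
  let Ψ : C(UnitAddTorus (Fin d), ℂ) := ⟨torusFold G, continuous_torusFold hG hGc hcube⟩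
  have hc : UnitAddTorus.mFourierCoeff Ψ =
      fun n : Fin d → ℤ => 𝓕 G (WithLp.toLp 2 fun i => (n i : ℝ)) :=
    funext fun n => mFourierCoeff_torusFold hcube n
  have h := UnitAddTorus.hasSum_mFourier_series_apply_of_summable (f := Ψ) (by rwa [hc])
    (fun i => (x i : UnitAddCircle))
  rw [hc] at h
  have hx' : Ψ (fun i => (x i : UnitAddCircle)) = G x := by
    change torusFold G _ = _
    rw [torusFold_coe]
    congr 1
    ext i
    exact Int.fract_eq_self.2 (hx i)
  rw [hx'] at h
  simpa only [mFourier_coe, smul_eq_mul] using h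

end

/-! ### Dual bases and dual lattices -/

/-- Every basis has a dual one, up to a prescribed scalar. -/
theorem exists_dual_basis {d : ℕ} (e : Module.Basis (Fin d) ℝ (Rd d)) {c : ℝ} (hc : c ≠ 0) :
    ∃ ε : Module.Basis (Fin d) ℝ (Rd d), ∀ j k, inner ℝ (e j) (ε k) = if j = k then c else 0 := by
  have hB : (innerₗ (Rd d) : LinearMap.BilinForm ℝ (Rd d)).Nondegenerate :=
    ⟨fun x hx => inner_self_eq_zero.1 (hx x), fun x hx => inner_self_eq_zero.1 (hx x)⟩
  refine ⟨(LinearMap.BilinForm.dualBasis _ hB e).isUnitSMul (w := fun _ => c)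
    fun _ => hc.isUnit, fun j k => ?_⟩
  have h := LinearMap.BilinForm.apply_dualBasis_left hB e k j
  rw [innerₗ_apply_apply] at h
  rw [Module.Basis.isUnitSMul_apply, inner_smul_right, real_inner_comm, h]
  split_ifs <;> simp

theorem inner_sum_dual {d : ℕ} {e ε : Module.Basis (Fin d) ℝ (Rd d)} {c : ℝ}
    (h : ∀ j k, inner ℝ (e j) (ε k) = if j = k then c else 0) (t r : Fin d → ℝ) :
    inner ℝ (∑ j, t j • e j) (∑ k, r k • ε k) = c * ∑ j, t j * r j := by
  rw [sum_inner, Finset.mul_sum]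
  refine Finset.sum_congr rfl fun j _ => ?_
  rw [inner_sum]
  simp only [inner_smul_left, inner_smul_right, h, conj_trivial]
  simp
  ring

/-- The right-hand side depends on the lattice of `e` only, not on its basis. So `Λ₂` may be
described by the basis dual to whichever basis of `Λ₁` spans the parallelepiped. -/
theorem latticeOf_eq_dual {d : ℕ} {e ε : Module.Basis (Fin d) ℝ (Rd d)} {c : ℝ} (hc : c ≠ 0)
    (h : ∀ j k, inner ℝ (e j) (ε k) = if j = k then c else 0) :
    latticeOf ε = {y | ∀ x ∈ latticeOf e, ∃ n : ℤ, inner ℝ x y = c * n} := by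
  ext y
  constructor
  · rintro ⟨a, rfl⟩ x ⟨b, rfl⟩
    refine ⟨∑ j, b j * a j, ?_⟩
    rw [inner_sum_dual h]
    push_cast
    rfl
  · intro hy
    have hej : ∀ j, e j ∈ latticeOf e := fun j => ⟨Pi.single j 1, by simp [Pi.single_apply]⟩
    choose n hn using fun j => hy (e j) (hej j)
    refine ⟨n, ?_⟩
    rw [← ε.sum_equivFun y]
    refine Finset.sum_congr rfl fun j _ => ?_
    have h1 := hn j
    have h2 := inner_sum_dual h (Pi.single j 1) (ε.equivFun y)
    rw [ε.sum_equivFun y] at h2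
    simp [Pi.single_apply] at h2
    rw [h2] at h1
    rw [← mul_left_cancel₀ hc h1]
    simp

/-! ### Separation of cones -/

/-- Cone separation: `ξ ∈ Γ₀` and `η ∉ Γ` are far apart. -/
theorem exists_cone_separation {d : ℕ} {Γ Γ₀ : Set (Rd d)} (hΓ : IsOpenCone Γ) (hΓ₀ : IsOpenCone Γ₀)
    (h : closure Γ₀ \ {0} ⊆ Γ) :
    ∃ δ : ℝ, 0 < δ ∧ ∀ ξ ∈ Γ₀, ∀ η ∉ Γ, δ * ‖ξ‖ ≤ ‖ξ - η‖ := by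
  set S := closure Γ₀ ∩ Metric.sphere (0 : Rd d) 1 with hS
  -- The unit vectors of the closed smaller cone form a compact set disjoint from the closed set
  -- `Γᶜ`, hence at positive distance; homogeneity supplies the factor `‖ξ‖`.
  have hSc : IsCompact S := (isCompact_sphere _ _).inter_left isClosed_closure
  have hdisj : Disjoint S Γᶜ := by
    rw [disjoint_compl_right_iff_subset]
    rintro x ⟨hx, hx1⟩
    refine h ⟨hx, ?_⟩
    rintro rfl
    simp at hx1
  obtain ⟨δ, hδ, hsep⟩ := Metric.exists_pos_forall_lt_edist hSc hΓ.1.isClosed_compl hdisj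
  refine ⟨δ, by exact_mod_cast hδ, fun ξ hξ η hη => ?_⟩
  by_cases h0 : ξ = 0
  · simp [h0]
  have hn : 0 < ‖ξ‖ := norm_pos_iff.2 h0
  have h1 : ‖ξ‖⁻¹ • ξ ∈ S := by
    refine ⟨subset_closure (hΓ₀.2 ξ hξ _ (inv_pos.2 hn)), ?_⟩
    rw [mem_sphere_zero_iff_norm, norm_smul, norm_inv, norm_norm, inv_mul_cancel₀ hn.ne']
  have h2 : ‖ξ‖⁻¹ • η ∈ Γᶜ := by
    intro hcon
    have := hΓ.2 _ hcon ‖ξ‖ hn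
    rw [smul_smul, mul_inv_cancel₀ hn.ne', one_smul] at this
    exact hη this
  have h3 := (hsep _ h1 _ h2).le
  rw [edist_nndist, ENNReal.coe_le_coe, ← NNReal.coe_le_coe, coe_nndist, dist_eq_norm, ← smul_sub,
    norm_smul, norm_inv, norm_norm, ← div_eq_inv_mul, le_div_iff₀ hn] at h3
  exact h3

/-! ### Sequences in `ℓ^q` and Young's inequality -/

/-- `F ∈ ℓ^q` for `[0,∞]`-valued `F`. -/
def LqFinite {ι : Type*} (q : ℝ≥0∞) (F : ι → ℝ≥0∞) : Prop :=
  if q = ∞ then ⨆ a, F a < ∞ else ∑' a, F a ^ q.toReal < ∞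

theorem one_le_toReal {q : ℝ≥0∞} (hq : 1 ≤ q) (hq' : q ≠ ∞) : 1 ≤ q.toReal := by
  simpa using (ENNReal.toReal_le_toReal ENNReal.one_ne_top hq').2 hq

/-- The cone is moved into an indicator so that sums run over the whole index set, to be taken as
the group `ℤ^d`, where convolution makes sense. For finite `q` the outer power `1 / q` does not
affect finiteness. -/
theorem discreteSeminorm_lt_top_iff {d : ℕ} {s : ℝ} (hs : 1 < s) {q : ℝ≥0∞} (hq : 1 ≤ q)
    (ω : Rd d → ℝ) {ι : Type*} {y : ι → Rd d} (hy : Function.Injective y) (Γ : Set (Rd d))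
    (f : CompactUltradistribution d s) :
    discreteSeminorm hs q ω (Γ ∩ range y) f < ⊤ ↔
      LqFinite q fun a => Γ.indicator (fun ξ => ‖ultraFourier hs f ξ * ω ξ‖ₑ) (y a) := by
  unfold discreteSeminorm LqFinite
  split_ifs with h
  · have : ⨆ ξ ∈ Γ ∩ range y, ‖ultraFourier hs f ξ * ω ξ‖ₑ =
        ⨆ a, Γ.indicator (fun ξ => ‖ultraFourier hs f ξ * ω ξ‖ₑ) (y a) := by
      apply le_antisymm
      · refine iSup₂_le ?_
        rintro _ ⟨hξ, a, rfl⟩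
        refine le_iSup_of_le a ?_
        rw [indicator_of_mem hξ]
      · refine iSup_le fun a => ?_
        by_cases ha : y a ∈ Γ
        · rw [indicator_of_mem ha]
          exact le_iSup₂ (f := fun ξ (_ : ξ ∈ Γ ∩ range y) => ‖ultraFourier hs f ξ * ω ξ‖ₑ) (y a)
            ⟨ha, mem_range_self a⟩
        · rw [indicator_of_notMem ha]
          exact bot_le
    rw [this]
  · have hq0 : 0 < q.toReal := by linarith [one_le_toReal hq h]
    have : ∑' ξ : ↥(Γ ∩ range y), ‖ultraFourier hs f ξ * ω ξ‖ₑ ^ q.toReal =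
        ∑' a, Γ.indicator (fun ξ => ‖ultraFourier hs f ξ * ω ξ‖ₑ) (y a) ^ q.toReal := by
      rw [tsum_subtype (Γ ∩ range y) fun ξ => ‖ultraFourier hs f ξ * ω ξ‖ₑ ^ q.toReal,
        ← hy.tsum_eq]
      · refine tsum_congr fun a => ?_
        by_cases ha : y a ∈ Γ
        · rw [indicator_of_mem ha, indicator_of_mem (show y a ∈ Γ ∩ range y from ⟨ha, mem_range_self a⟩)]
        · rw [indicator_of_notMem ha, indicator_of_notMem fun hh => ha hh.1,
            ENNReal.zero_rpow_of_pos hq0]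
      · exact support_indicator_subset.trans inter_subset_right
    rw [this, ENNReal.rpow_lt_top_iff_of_pos (by positivity)]

theorem LqFinite.mono {ι : Type*} {q : ℝ≥0∞} {F G : ι → ℝ≥0∞} (hF : LqFinite q F)
    (h : ∀ a, G a ≤ F a) : LqFinite q G := by
  unfold LqFinite at *
  split_ifs with hq
  · rw [if_pos hq] at hF
    exact (iSup_mono h).trans_lt hF
  · rw [if_neg hq] at hF
    exact (ENNReal.tsum_le_tsum fun a => ENNReal.rpow_le_rpow (h a)
      ENNReal.toReal_nonneg).trans_lt hF

theorem LqFinite.add {ι : Type*} {q : ℝ≥0∞} (hq : 1 ≤ q) {F G : ι → ℝ≥0∞} (hF : LqFinite q F)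
    (hG : LqFinite q G) : LqFinite q fun a => F a + G a := by
  unfold LqFinite at *
  split_ifs with h
  · rw [if_pos h] at hF hG
    exact (iSup_le fun a => add_le_add (le_iSup F a) (le_iSup G a)).trans_lt
      (ENNReal.add_lt_top.2 ⟨hF, hG⟩)
  · rw [if_neg h] at hF hG
    refine (ENNReal.tsum_le_tsum fun a => ENNReal.rpow_add_le_mul_rpow_add_rpow (F a) (G a)
      (one_le_toReal hq h)).trans_lt ?_
    rw [ENNReal.tsum_mul_left, ENNReal.tsum_add]
    exact ENNReal.mul_lt_top (ENNReal.rpow_lt_top_of_nonneg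
      (by linarith [one_le_toReal hq h]) ENNReal.ofNat_ne_top) (ENNReal.add_lt_top.2 ⟨hF, hG⟩)

/-- For entries at most `1`, raising to a power `≥ 1` only decreases them. -/
theorem LqFinite.of_summable {ι : Type*} {q : ℝ≥0∞} (hq : 1 ≤ q) {F : ι → ℝ≥0∞}
    (h1 : ∀ a, F a ≤ 1) (hF : ∑' a, F a < ∞) : LqFinite q F := by
  unfold LqFinite
  split_ifs with h
  · exact (iSup_le h1).trans_lt ENNReal.one_lt_top
  · exact (ENNReal.tsum_le_tsum fun a =>
      ENNReal.rpow_le_self_of_le_one (h1 a) (one_le_toReal hq h)).trans_lt hF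

/-- Weighted Hölder (Jensen) for finite sums, then the supremum over finite sets. -/
theorem tsum_mul_rpow_le {ι : Type*} {p : ℝ} (hp : 1 ≤ p) (w f : ι → ℝ≥0∞) :
    (∑' i, w i * f i) ^ p ≤ (∑' i, w i) ^ (p - 1) * ∑' i, w i * f i ^ p := by
  have hp0 : 0 < p := by linarith
  have key : ∑' i, w i * f i ≤
      (∑' i, w i) ^ (1 - p⁻¹) * (∑' i, w i * f i ^ p) ^ p⁻¹ := by
    rw [ENNReal.tsum_eq_iSup_sum (f := fun i => w i * f i)]
    refine iSup_le fun S => (ENNReal.inner_le_weight_mul_Lp_of_nonneg S hp w f).trans ?_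
    gcongr
    · rw [sub_nonneg]; exact inv_le_one_of_one_le₀ hp
    · exact ENNReal.sum_le_tsum S
    · exact ENNReal.sum_le_tsum (f := fun i => w i * f i ^ p) S
  refine (ENNReal.rpow_le_rpow key hp0.le).trans (le_of_eq ?_)
  rw [ENNReal.mul_rpow_of_nonneg _ _ hp0.le, ← ENNReal.rpow_mul, ← ENNReal.rpow_mul,
    inv_mul_cancel₀ hp0.ne', ENNReal.rpow_one, sub_mul, inv_mul_cancel₀ hp0.ne', one_mul]

/-- `ℓ¹ * ℓ^q ⊆ ℓ^q`. -/
theorem LqFinite.convolution {ι : Type*} [AddCommGroup ι] {q : ℝ≥0∞} (hq : 1 ≤ q)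
    {β F : ι → ℝ≥0∞} (hβ : ∑' b, β b < ∞) (hF : LqFinite q F) :
    LqFinite q fun a => ∑' b, β b * F (a - b) := by
  unfold LqFinite at *
  split_ifs with h
  · rw [if_pos h] at hF
    refine lt_of_le_of_lt (iSup_le fun a => ENNReal.tsum_le_tsum fun b =>
      mul_le_mul_right (le_iSup F (a - b)) (β b)) ?_
    rw [ENNReal.tsum_mul_right]
    exact ENNReal.mul_lt_top hβ hF
  · rw [if_neg h] at hF
    have hp := one_le_toReal hq h
    -- Jensen with weights `β`, then Tonelli: each inner sum over `a` is a translate of the full sum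
    -- of `F ^ q`.
    refine (ENNReal.tsum_le_tsum fun a => tsum_mul_rpow_le hp β fun b => F (a - b)).trans_lt ?_
    rw [ENNReal.tsum_mul_left, ENNReal.tsum_comm]
    have : ∀ b, ∑' a, β b * F (a - b) ^ q.toReal = β b * ∑' a, F a ^ q.toReal := by
      intro b
      rw [ENNReal.tsum_mul_left]
      congr 1
      exact (Equiv.subRight b).tsum_eq fun a => F a ^ q.toReal
    simp only [this]
    rw [ENNReal.tsum_mul_right]
    exact ENNReal.mul_lt_top (ENNReal.rpow_lt_top_of_nonneg (by linarith) hβ.ne)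
      (ENNReal.mul_lt_top hβ hF)

/-! ### Expansion in characters of the dual lattice -/

theorem norm_expFun {d : ℕ} (ξ x : Rd d) : ‖expFun ξ x‖ = 1 := by
  simp [expFun, Complex.norm_exp]

theorem expFun_mul_expFun {d : ℕ} (ξ η x : Rd d) : expFun ξ x * expFun η x = expFun (ξ + η) x := by
  unfold expFun
  rw [← Complex.exp_add, inner_add_right]
  congr 1
  push_cast
  ring

/-- Points of an open subset of a parallelepiped have coordinates in `(0, 1)`. -/
theorem repr_mem_Ioo {d : ℕ} {e : Module.Basis (Fin d) ℝ (Rd d)} {x₀ : Rd d} {U : Set (Rd d)}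
    (hU : IsOpen U) (hUD : U ⊆ {x | ∃ t : Fin d → ℝ, (∀ j, t j ∈ Icc (0 : ℝ) 1) ∧
      x = x₀ + ∑ j, t j • e j}) {x : Rd d} (hx : x ∈ U) (j : Fin d) :
    e.equivFun (x - x₀) j ∈ Ioo (0 : ℝ) 1 := by
  have hmem : ∀ z ∈ U, e.equivFun (z - x₀) j ∈ Icc (0 : ℝ) 1 := by
    intro z hz
    obtain ⟨t, ht, rfl⟩ := hUD hz
    rw [add_sub_cancel_left, ← e.equivFun_symm_apply, LinearEquiv.apply_symm_apply]
    exact ht j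
  -- A small step from `x` in either direction along `e j` stays in `U`, so the coordinate cannot be
  -- an endpoint of `[0, 1]`.
  have hc : Continuous fun δ : ℝ => x + δ • e j := by fun_prop
  have hev : ∀ᶠ δ : ℝ in 𝓝 0, x + δ • e j ∈ U :=
    hc.continuousAt.eventually (hU.mem_nhds (by simpa using hx))
  obtain ⟨r, hr, hball⟩ := Metric.eventually_nhds_iff.1 hev
  have hcoord : ∀ δ : ℝ, e.equivFun (x + δ • e j - x₀) j = e.equivFun (x - x₀) j + δ := by
    intro δ
    rw [show x + δ • e j - x₀ = (x - x₀) + δ • e j by abel, map_add, map_smul]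
    simp
  have h1 := hmem _ (hball (y := r / 2) (by rw [Real.dist_eq, sub_zero, abs_of_pos] <;> linarith))
  have h2 := hmem _ (hball (y := -(r / 2)) (by
    rw [Real.dist_eq, sub_zero, abs_neg, abs_of_pos] <;> linarith))
  rw [hcoord] at h1 h2
  exact ⟨by linarith [h2.1], by linarith [h1.2]⟩

theorem isCompact_unit_cube (d : ℕ) : IsCompact {x : Rd d | ∀ i, x i ∈ Icc (0 : ℝ) 1} := by
  have h : IsCompact ((fun y : Fin d → ℝ => (WithLp.toLp 2 y : Rd d)) ''
      Set.pi univ fun _ => Icc (0 : ℝ) 1) :=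
    (isCompact_univ_pi fun _ => isCompact_Icc).image (PiLp.continuous_toLp 2 _)
  convert h using 1
  ext x
  constructor
  · exact fun hx => ⟨WithLp.ofLp x, fun i _ => hx i, rfl⟩
  · rintro ⟨y, hy, rfl⟩ i
    exact hy i (mem_univ i)

/-- A Beurling test function supported in an open subset of the parallelepiped spanned by `e`
coincides there with a rapidly converging series of characters with frequencies in the dual
lattice. -/
theorem exists_fourier_expansion {d : ℕ} {s : ℝ} (hs : 1 < s)
    {e ε : Module.Basis (Fin d) ℝ (Rd d)} {c : ℝ} (hc : 0 < c) (hc2 : c ≤ 2 * Real.pi)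
    (hdual : ∀ j k, inner ℝ (e j) (ε k) = if j = k then c else 0)
    (x₀ : Rd d) {U : Set (Rd d)} (hU : IsOpen U)
    (hUD : U ⊆ {x | ∃ t : Fin d → ℝ, (∀ j, t j ∈ Icc (0 : ℝ) 1) ∧ x = x₀ + ∑ j, t j • e j})
    {ψ : Rd d → ℂ} (hψ : UniformBeurling s ψ) (hψU : tsupport ψ ⊆ U) {N : ℝ} (hN : 0 < N) :
    ∃ (b : (Fin d → ℤ) → ℂ) (C : ℝ), 0 ≤ C ∧
      (∀ n, ‖b n‖ ≤ C * Real.exp (-(N * ‖∑ j, (n j : ℝ) • ε j‖ ^ (1 / s)))) ∧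
      ∀ x ∈ U, HasSum (fun n => b n * expFun (-∑ j, (n j : ℝ) • ε j) x) (ψ x) := by
  have hs0 : 0 < s := by linarith
  -- The characters have periods `T • e j`. The map `L` below carries the unit cube to this period
  -- cell, and `T ≥ 1`, i.e. `c ≤ 2π`, makes `U - x₀` fit inside it.
  set T : ℝ := 2 * Real.pi / c with hT
  have hT1 : 1 ≤ T := by rw [hT, le_div_iff₀ hc]; linarith
  have hT0 : 0 < T := by linarith
  let Ll : Rd d →ₗ[ℝ] Rd d :=
    { toFun := fun τ => ∑ j, (T * τ j) • e j
      map_add' := fun τ τ' => by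
        simp [mul_add, add_smul, Finset.sum_add_distrib]
      map_smul' := fun r τ => by
        simp only [PiLp.smul_apply, smul_eq_mul, RingHom.id_apply, Finset.smul_sum, smul_smul]
        refine Finset.sum_congr rfl fun j _ => ?_
        congr 1; ring }
  let L : Rd d →L[ℝ] Rd d := LinearMap.toContinuousLinearMap Ll
  have hL : ∀ τ, L τ = ∑ j, (T * τ j) • e j := fun τ => rfl
  set G : Rd d → ℂ := fun τ => ψ (x₀ + L τ) with hG
  have hGB : UniformBeurling s G := hψ.comp_affine L x₀
  have hcubeU : ∀ τ, x₀ + L τ ∈ U → ∀ i, τ i ∈ Ioo (0 : ℝ) 1 := by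
    intro τ hτ i
    have h1 := repr_mem_Ioo hU hUD hτ i
    rw [add_sub_cancel_left, hL, ← e.equivFun_symm_apply fun j => T * τ j,
      LinearEquiv.apply_symm_apply] at h1
    have h2 : 0 < τ i := pos_of_mul_pos_right h1.1 hT0.le
    refine ⟨h2, ?_⟩
    nlinarith [h1.2]
  have hcube : tsupport G ⊆ {τ | ∀ i, τ i ∈ Ioo (0 : ℝ) 1} := by
    have h1 : tsupport G ⊆ (fun τ => x₀ + L τ) ⁻¹' tsupport ψ := by
      refine closure_minimal (fun τ hτ => subset_tsupport ψ hτ) ?_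
      exact (isClosed_tsupport ψ).preimage (continuous_const.add L.continuous)
    exact fun τ hτ => hcubeU τ (hψU (h1 hτ))
  have hGc : HasCompactSupport G :=
    (isCompact_unit_cube d).of_isClosed_subset (isClosed_tsupport _)
      (hcube.trans fun τ hτ i => Ioo_subset_Icc_self (hτ i))
  -- Compares a lattice point with its integer coordinates, so that decay at rate `N * ℓ ^ (1 / s)`
  -- in the coordinates gives rate `N` in the lattice point.
  set ℓ : ℝ := ∑ j, ‖ε j‖ + 1 with hℓ
  have hℓ0 : 0 < ℓ := by positivity
  have hyℓ : ∀ n : Fin d → ℤ, ‖∑ j, (n j : ℝ) • ε j‖ ≤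
      ℓ * ‖(WithLp.toLp 2 fun i => (n i : ℝ) : Rd d)‖ := by
    intro n
    refine (norm_sum_le _ _).trans ?_
    calc ∑ j, ‖(n j : ℝ) • ε j‖
        ≤ ∑ j, ‖(WithLp.toLp 2 fun i => (n i : ℝ) : Rd d)‖ * ‖ε j‖ := by
          refine Finset.sum_le_sum fun j _ => ?_
          rw [norm_smul]
          gcongr
          exact PiLp.norm_apply_le (WithLp.toLp 2 fun i => (n i : ℝ) : Rd d) j
      _ = (∑ j, ‖ε j‖) * ‖(WithLp.toLp 2 fun i => (n i : ℝ) : Rd d)‖ := by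
          rw [← Finset.mul_sum, mul_comm]
      _ ≤ _ := by
          gcongr
          linarith
  obtain ⟨C, hC, hdec⟩ := hGB.exists_norm_fourier_le hs hGc (N := N * ℓ ^ (1 / s)) (by positivity)
  have hdec' : ∀ n : Fin d → ℤ, ‖𝓕 G (WithLp.toLp 2 fun i => (n i : ℝ))‖ ≤
      C * Real.exp (-(N * ‖∑ j, (n j : ℝ) • ε j‖ ^ (1 / s))) := by
    intro n
    refine (hdec _).trans
      (mul_le_mul_of_nonneg_left (Real.exp_le_exp.2 (neg_le_neg ?_)) hC)
    rw [mul_assoc, ← Real.mul_rpow hℓ0.le (norm_nonneg _)]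
    gcongr
    exact hyℓ n
  have hsum : Summable fun n : Fin d → ℤ => 𝓕 G (WithLp.toLp 2 fun i => (n i : ℝ)) :=
    Summable.of_norm_bounded ((summable_exp_neg_lattice hs ε hN).mul_left C) hdec'
  -- The unimodular factor at `x₀` accounts for the translation of the cell to the corner `x₀`.
  refine ⟨fun n => 𝓕 G (WithLp.toLp 2 fun i => (n i : ℝ)) * expFun (∑ j, (n j : ℝ) • ε j) x₀, C, hC,
    fun n => ?_, fun x hx => ?_⟩
  · rw [norm_mul, norm_expFun, mul_one]
    exact hdec' n
  · set τ : Rd d := WithLp.toLp 2 fun j => e.equivFun (x - x₀) j / T with hτ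
    have hLτ : L τ = x - x₀ := by
      rw [hL, ← e.sum_equivFun (x - x₀)]
      refine Finset.sum_congr rfl fun j _ => ?_
      congr 1
      change T * (e.equivFun (x - x₀) j / T) = _
      field_simp
    have hxτ : x₀ + L τ = x := by rw [hLτ]; abel
    have h1 := hasSum_fourier_cube hGB.1.continuous hGc hcube hsum τ fun i =>
      Ioo_subset_Ico_self (hcubeU τ (by rwa [hxτ]) i)
    have hGτ : G τ = ψ x := by rw [hG]; simp only [hxτ]
    rw [hGτ] at h1
    convert h1 using 2 with n
    rw [mul_assoc]
    congr 1
    unfold expFun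
    rw [← Complex.exp_add]
    congr 1
    have h2 : inner ℝ x (∑ j, (n j : ℝ) • ε j) = inner ℝ x₀ (∑ j, (n j : ℝ) • ε j) +
        2 * Real.pi * ∑ i, (n i : ℝ) * τ i := by
      have h3 := inner_sum_dual hdual (fun j => T * τ j) fun j => (n j : ℝ)
      rw [← hL, hLτ, inner_sub_left] at h3
      rw [sub_eq_iff_eq_add'] at h3
      rw [h3, Finset.mul_sum, Finset.mul_sum]
      congr 1
      refine Finset.sum_congr rfl fun j _ => ?_
      rw [hT]
      field_simp
    rw [inner_neg_right, h2]
    push_cast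
    ring

/-! ### The convolution formula, the pointwise estimate and the conclusion -/

/-- Localization of the Fourier transform of a product as a discrete convolution. -/
theorem ultraFourier_mulUltra {d : ℕ} {s : ℝ} (hs : 1 < s) (f : CompactUltradistribution d s)
    (φ : RoumieuSpace d s) {ι : Type} (b : ι → ℂ) (y : ι → Rd d)
    (hb : Summable fun a => ‖b a‖ * Real.exp (s * ‖y a‖ ^ (1 / s)))
    (hφ : ∀ᶠ x in 𝓝ˢ (ultraSupport f), HasSum (fun a => b a * expFun (-y a) x) (φ.fn x))
    (ξ : Rd d) :
    HasSum (fun a => b a * ultraFourier hs f (ξ - y a)) (ultraFourier hs (mulUltra hs φ f) ξ) := by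
  have hb' : Summable fun a => ‖b a‖ * Real.exp (s * ‖-y a‖ ^ (1 / s)) := by simpa using hb
  have h1 := hasSum_apply_expSeries hs (mulUltra hs (expTest hs ξ) f) b (fun a => -y a) hb'
  set Ψ : RoumieuSpace d s := RoumieuSpace.mk _ (expSeries_mem hs b (fun a => -y a) hb')
  -- The series represents `φ` only near the support of `f`; by locality that is all `f` can see.
  have h2 : mulUltra hs (expTest hs ξ) f Ψ = f (mulTest hs φ (expTest hs ξ)) := by
    rw [mulUltra_apply, ← sub_eq_zero, ← map_sub]
    refine apply_eq_zero_of_eventually hs f _ ?_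
    filter_upwards [hφ] with x hx
    change expFun ξ x * (∑' a, b a * expFun (-y a) x) - φ.fn x * expFun ξ x = 0
    rw [hx.tsum_eq]
    ring
  have h3 : ∀ a, mulUltra hs (expTest hs ξ) f (expTest hs (-y a)) = f (expTest hs (ξ - y a)) := by
    intro a
    rw [mulUltra_apply]
    congr 1
    refine RoumieuSpace.ext_fn fun x => ?_
    change expFun ξ x * expFun (-y a) x = expFun (ξ - y a) x
    rw [expFun_mul_expFun, sub_eq_add_neg]
  rw [h2] at h1
  simp only [h3] at h1
  have h4 := h1.mul_left (((2 * Real.pi) ^ (-(d : ℝ) / 2) : ℝ) : ℂ)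
  have h5 : (fun a => b a * ultraFourier hs f (ξ - y a)) = fun a =>
      (((2 * Real.pi) ^ (-(d : ℝ) / 2) : ℝ) : ℂ) * (b a * f (expTest hs (ξ - y a))) :=
    funext fun a => mul_left_comm _ _ _
  rw [h5]
  exact h4

theorem isCompact_parallelepiped {d : ℕ} (e : Module.Basis (Fin d) ℝ (Rd d)) (x₀ : Rd d) :
    IsCompact {x | ∃ t : Fin d → ℝ, (∀ j, t j ∈ Icc (0 : ℝ) 1) ∧ x = x₀ + ∑ j, t j • e j} := by
  have h : IsCompact ((fun t : Fin d → ℝ => x₀ + ∑ j, t j • e j) ''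
      Set.pi univ fun _ => Icc (0 : ℝ) 1) :=
    (isCompact_univ_pi fun _ => isCompact_Icc).image (by fun_prop)
  convert h using 1
  ext x
  constructor
  · rintro ⟨t, ht, rfl⟩
    exact ⟨t, fun i _ => ht i, rfl⟩
  · rintro ⟨t, ht, rfl⟩
    exact ⟨t, fun i => ht i (mem_univ i), rfl⟩

theorem isClosed_ultraSupport {d : ℕ} {s : ℝ} (f : CompactUltradistribution d s) :
    IsClosed (ultraSupport f) :=
  (isOpen_sUnion fun _ hU => hU.1).isClosed_compl

/-- The pointwise estimate behind the convolution bound. -/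
theorem exists_pointwise_bound {d : ℕ} {s : ℝ} (hs : 1 < s) {ω : Rd d → ℝ}
    (hω : ω ∈ roumieuWeights d s) (f : CompactUltradistribution d s) {Γ Γ₀ : Set (Rd d)}
    (hΓ : IsOpenCone Γ) (hΓ₀ : IsOpenCone Γ₀) (h : closure Γ₀ \ {0} ⊆ Γ) :
    ∃ N D : ℝ, s + 1 ≤ N ∧ 0 ≤ D ∧ ∀ ξ ∈ Γ₀, ∀ z : Rd d,
      Real.exp (-(N * ‖z‖ ^ (1 / s))) * ‖ultraFourier hs f (ξ - z) * ω ξ‖ ≤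
        D * Real.exp (-(‖z‖ ^ (1 / s))) *
          (Γ.indicator (fun η => ‖ultraFourier hs f η * ω η‖) (ξ - z) +
            Real.exp (-(‖ξ - z‖ ^ (1 / s)))) := by
  have hs0 : 0 < s := by linarith
  obtain ⟨hω0, v, hv0, -, ⟨Cv, k, hCv, hk, hv⟩, Cω, hCω, hmod⟩ := hω
  obtain ⟨Cf, hCf, hgrow⟩ := exists_norm_ultraFourier_le hs f
  obtain ⟨δ, hδ, hsep⟩ := exists_cone_separation hΓ hΓ₀ h
  -- When `ξ - z ∉ Γ`, both `‖ξ‖` and `‖ξ - z‖` are at most `(1 / δ + 1) * ‖z‖`, so their powers `1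
  -- / s` are at most `ρ * ‖z‖ ^ (1 / s)`.
  set ρ : ℝ := (1 / δ + 1) ^ (1 / s) with hρ
  have hρ0 : 0 ≤ ρ := by positivity
  -- The terms pay, in order, for the surviving decay in `z`, the decay in `ξ - z`, the growth of
  -- `f̂` and of `ω` off `Γ`, the shift of the weight inside `Γ`, and the requirement `s + 1 ≤ N`,
  -- used for summability of the expansion.
  set N : ℝ := 1 + ρ + s * ρ + k * ρ + k + s with hN
  set D : ℝ := Cω * Cv * (1 + Cf * ω 0) with hD
  have hω00 := hω0 0
  refine ⟨N, D, ?_, by positivity, fun ξ hξ z => ?_⟩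
  · nlinarith [mul_nonneg hs0.le hρ0, mul_nonneg hk.le hρ0]
  set u : ℝ := ‖z‖ ^ (1 / s) with hu
  have hu0 : 0 ≤ u := by positivity
  have hnorm : ∀ η : Rd d, ‖ultraFourier hs f η * (ω ξ : ℂ)‖ = ‖ultraFourier hs f η‖ * ω ξ := by
    intro η
    rw [norm_mul, Complex.norm_real, Real.norm_of_nonneg (hω0 ξ)]
  by_cases hz : ξ - z ∈ Γ
  · rw [indicator_of_mem hz, hnorm]
    have h1 : ω ξ ≤ Cω * (Cv * Real.exp (k * u)) * ω (ξ - z) := by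
      have := hmod z (ξ - z)
      rw [add_sub_cancel] at this
      refine this.trans ?_
      gcongr
      · exact hω0 _
      · exact hv z
    have h2 : ‖ultraFourier hs f (ξ - z) * (ω (ξ - z) : ℂ)‖ =
        ‖ultraFourier hs f (ξ - z)‖ * ω (ξ - z) := by
      rw [norm_mul, Complex.norm_real, Real.norm_of_nonneg (hω0 _)]
    rw [h2]
    have h3 : Real.exp (-(N * u)) * Real.exp (k * u) ≤ Real.exp (-u) := by
      rw [← Real.exp_add]
      apply Real.exp_le_exp.2
      nlinarith [mul_nonneg hρ0 hu0, mul_nonneg (mul_nonneg hs0.le hρ0) hu0,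
        mul_nonneg (mul_nonneg hk.le hρ0) hu0, mul_nonneg hs0.le hu0]
    have h5 := hω0 (ξ - z)
    have h4 : Cω * Cv ≤ D := by
      rw [hD]
      exact le_mul_of_one_le_right (by positivity) (by linarith [mul_nonneg hCf hω00])
    calc Real.exp (-(N * u)) * (‖ultraFourier hs f (ξ - z)‖ * ω ξ)
        ≤ Real.exp (-(N * u)) * (‖ultraFourier hs f (ξ - z)‖ *
            (Cω * (Cv * Real.exp (k * u)) * ω (ξ - z))) := by gcongr
      _ = (Cω * Cv) * (Real.exp (-(N * u)) * Real.exp (k * u)) *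
            (‖ultraFourier hs f (ξ - z)‖ * ω (ξ - z)) := by ring
      _ ≤ D * Real.exp (-u) * (‖ultraFourier hs f (ξ - z)‖ * ω (ξ - z) +
            Real.exp (-(‖ξ - z‖ ^ (1 / s)))) := by
          gcongr
          exact le_add_of_nonneg_right (Real.exp_nonneg _)
  · rw [indicator_of_notMem hz, zero_add, hnorm]
    have hξz := hsep ξ hξ _ hz
    rw [sub_sub_cancel] at hξz
    have h1 : ‖ξ‖ ≤ (1 / δ) * ‖z‖ := by
      rw [one_div_mul_eq_div, le_div_iff₀ hδ]; linarith
    have h2 : ‖ξ‖ ^ (1 / s) ≤ ρ * u := by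
      rw [hρ, hu, ← Real.mul_rpow (by positivity) (norm_nonneg z)]
      gcongr
      refine h1.trans ?_
      gcongr
      linarith
    have h3 : ‖ξ - z‖ ^ (1 / s) ≤ ρ * u := by
      rw [hρ, hu, ← Real.mul_rpow (by positivity) (norm_nonneg z)]
      gcongr
      refine (norm_sub_le _ _).trans ?_
      linarith
    -- Off `Γ` the weight is compared with its value at the origin; this is possible because `ξ`
    -- itself is controlled by `z`.
    have h4 : ω ξ ≤ Cω * (Cv * Real.exp (k * (ρ * u))) * ω 0 := by
      have := hmod ξ 0
      rw [add_zero] at this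
      refine this.trans ?_
      gcongr
      refine (hv ξ).trans ?_
      gcongr
    have h5 : ‖ultraFourier hs f (ξ - z)‖ ≤ Cf * Real.exp (s * (ρ * u)) := by
      refine (hgrow _).trans ?_
      gcongr
    have h6 : Real.exp (-(N * u)) * Real.exp (s * (ρ * u)) * Real.exp (k * (ρ * u)) ≤
        Real.exp (-u) * Real.exp (-(‖ξ - z‖ ^ (1 / s))) := by
      rw [← Real.exp_add, ← Real.exp_add, ← Real.exp_add]
      apply Real.exp_le_exp.2
      rw [hN]
      nlinarith [mul_nonneg hk.le hu0, mul_nonneg hs0.le hu0]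
    have h7 : Cω * Cv * (Cf * ω 0) ≤ D := by
      rw [hD]
      gcongr
      linarith
    calc Real.exp (-(N * u)) * (‖ultraFourier hs f (ξ - z)‖ * ω ξ)
        ≤ Real.exp (-(N * u)) * ((Cf * Real.exp (s * (ρ * u))) *
            (Cω * (Cv * Real.exp (k * (ρ * u))) * ω 0)) := by
          have := hω0 ξ
          gcongr
      _ = (Cω * Cv * (Cf * ω 0)) *
            (Real.exp (-(N * u)) * Real.exp (s * (ρ * u)) * Real.exp (k * (ρ * u))) := by ring
      _ ≤ D * (Real.exp (-u) * Real.exp (-(‖ξ - z‖ ^ (1 / s)))) := by gcongr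
      _ = _ := by ring

theorem corollary4p3 (d : ℕ) (s : ℝ) (hs : 1 < s) (q : ℝ≥0∞) (hq : 1 ≤ q)
    (ω : Rd d → ℝ) (hω : ω ∈ roumieuWeights d s)
    (Λ₁ Λ₂ : Set (Rd d)) (hΛ : IsAdmissibleLatticePair Λ₁ Λ₂)
    (D₁ : Set (Rd d)) (hD₁ : D₁ ∈ parallelepipeds Λ₁)
    (f : CompactUltradistribution d s)
    (hf : ∃ U : Set (Rd d), IsOpen U ∧ ultraSupport f ⊆ U ∧ U ⊆ D₁)
    (Γ Γ₀ : Set (Rd d)) (hΓ : IsOpenCone Γ) (hΓ₀ : IsOpenCone Γ₀)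
    (hΓ₀Γ : closure Γ₀ \ {0} ⊆ Γ)
    (hfin : discreteSeminorm hs q ω (Γ ∩ Λ₂) f < ⊤)
    (X : Set (Rd d)) (hX : IsOpen X) (φ : Rd d → ℂ) (hφ : φ ∈ beurlingTest s X) :
    discreteSeminorm hs q ω (Γ₀ ∩ Λ₂) (mulUltra hs (RoumieuSpace.mk φ (beurlingTest_subset hφ)) f) < ⊤ := by
  obtain ⟨e₀, ε₀, he₀, hε₀, c, hc, hc2, hdiag, hoff⟩ := hΛ
  obtain ⟨x₀, -, e, he, hDe⟩ := hD₁
  obtain ⟨U, hU, hfU, hUD⟩ := hf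
  -- The basis `e` spanning `D₁` need not be the one from admissibility, so its own dual basis is
  -- used; it generates the same `Λ₂`.
  obtain ⟨ε, hdual⟩ := exists_dual_basis e hc.ne'
  have hΛ₂ : Λ₂ = latticeOf ε := by
    rw [hε₀, latticeOf_eq_dual (e := e₀) hc.ne' fun j k => ?_, latticeOf_eq_dual hc.ne' hdual,
      ← he₀, he]
    split_ifs with hjk
    · rw [← hjk]; exact hdiag j
    · exact hoff j k hjk
  set y : (Fin d → ℤ) → Rd d := fun n => ∑ j, (n j : ℝ) • ε j with hy
  have hyinj : Function.Injective y := by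
    intro a a' haa
    have h2 := congrArg ε.equivFun haa
    have e1 : ∀ c : Fin d → ℝ, ε.equivFun (∑ j, c j • ε j) = c := fun c => by
      rw [← ε.equivFun_symm_apply, LinearEquiv.apply_symm_apply]
    funext j
    have h3 := congrFun h2 j
    simp only [hy] at h3
    rw [e1 fun j => (a j : ℝ), e1 fun j => (a' j : ℝ)] at h3
    exact Int.cast_injective (α := ℝ) h3
  have hysub : ∀ a n, y a - y n = y (a - n) := by
    intro a n
    simp only [hy, ← Finset.sum_sub_distrib, ← sub_smul, Pi.sub_apply, Int.cast_sub]
  have hrange : Λ₂ = range y := by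
    rw [hΛ₂]
    ext x
    exact ⟨fun ⟨a, ha⟩ => ⟨a, ha.symm⟩, fun ⟨a, ha⟩ => ⟨a, ha.symm⟩⟩
  rw [hrange, discreteSeminorm_lt_top_iff hs hq ω hyinj] at hfin ⊢
  obtain ⟨N, D, hN, hD, hpt⟩ := exists_pointwise_bound hs hω f hΓ hΓ₀ hΓ₀Γ
  rw [hDe] at hUD
  have hsuppc : IsCompact (ultraSupport f) :=
    (isCompact_parallelepiped e x₀).of_isClosed_subset (isClosed_ultraSupport f) (hfU.trans hUD)
  obtain ⟨χ, hχ, -, hχU, hχ1⟩ := exists_cutoff hs hU hsuppc hfU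
  obtain ⟨b, C, hC, hb, hexp⟩ := exists_fourier_expansion hs hc hc2 hdual x₀ hU hUD
    (hχ.mul (by linarith) (uniformBeurling_of_mem_beurlingTest hs hφ))
    ((tsupport_mul_subset_left (f := χ) (g := φ)).trans hχU) (N := N) (by linarith)
  have hsum1 := summable_exp_neg_lattice hs ε one_pos
  simp only [one_mul] at hsum1
  have hbs : Summable fun n => ‖b n‖ * Real.exp (s * ‖y n‖ ^ (1 / s)) := by
    refine Summable.of_nonneg_of_le (fun n => by positivity) (fun n => ?_) (hsum1.mul_left C)
    calc ‖b n‖ * Real.exp (s * ‖y n‖ ^ (1 / s))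
        ≤ C * Real.exp (-(N * ‖y n‖ ^ (1 / s))) * Real.exp (s * ‖y n‖ ^ (1 / s)) := by
          gcongr
          exact hb n
      _ ≤ C * Real.exp (-(‖y n‖ ^ (1 / s))) := by
          rw [mul_assoc, ← Real.exp_add]
          gcongr
          have : 0 ≤ ‖y n‖ ^ (1 / s) := by positivity
          nlinarith
  have hconv := ultraFourier_mulUltra hs f (RoumieuSpace.mk φ (beurlingTest_subset hφ)) b y hbs (by
    filter_upwards [hχ1, hU.mem_nhdsSet.2 hfU] with x hx hxU
    have h1 := hexp x hxU
    rw [hx, one_mul] at h1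
    exact h1)
  set β : (Fin d → ℤ) → ℝ≥0∞ := fun n => ENNReal.ofReal (C * D * Real.exp (-(‖y n‖ ^ (1 / s)))) with hβ
  have hβfin : ∑' n, β n < ∞ := by
    have h1 := hsum1.mul_left (C * D)
    rw [hβ, ← ENNReal.ofReal_tsum_of_nonneg (fun n => by positivity) h1]
    exact ENNReal.ofReal_lt_top
  -- An `ℓ^q` majorant independent of `ξ`: the given sequence on `Γ`, plus a summable term that
  -- covers the frequencies outside `Γ`.
  set F : (Fin d → ℤ) → ℝ≥0∞ := fun m =>
    Γ.indicator (fun η => ‖ultraFourier hs f η * ω η‖ₑ) (y m) +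
      ENNReal.ofReal (Real.exp (-(‖y m‖ ^ (1 / s)))) with hF
  have hFfin : LqFinite q F := by
    refine hfin.add hq (LqFinite.of_summable hq (fun m => ?_) ?_)
    · rw [ENNReal.ofReal_le_one]
      exact Real.exp_le_one_iff.2 (neg_nonpos.2 (by positivity))
    · rw [← ENNReal.ofReal_tsum_of_nonneg (fun n => by positivity) hsum1]
      exact ENNReal.ofReal_lt_top
  refine (LqFinite.convolution hq hβfin hFfin).mono fun a => ?_
  by_cases ha : y a ∈ Γ₀
  swap
  · rw [indicator_of_notMem ha]
    exact bot_le
  rw [indicator_of_mem ha, ← ((hconv (y a)).mul_right _).tsum_eq]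
  refine enorm_tsum_le_tsum_enorm.trans (ENNReal.tsum_le_tsum fun n => ?_)
  have h1 := hpt (y a) ha (y n)
  have hI : Γ.indicator (fun η => ‖ultraFourier hs f η * ω η‖ₑ) (y (a - n)) =
      ENNReal.ofReal (Γ.indicator (fun η => ‖ultraFourier hs f η * ω η‖) (y (a - n))) := by
    by_cases hm : y (a - n) ∈ Γ
    · rw [indicator_of_mem hm, indicator_of_mem hm, ofReal_norm]
    · rw [indicator_of_notMem hm, indicator_of_notMem hm, ENNReal.ofReal_zero]
  rw [hysub] at h1
  simp only [hF, hβ]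
  rw [hI, ← ENNReal.ofReal_add (indicator_nonneg (fun _ _ => norm_nonneg _) _) (Real.exp_nonneg _),
    ← ENNReal.ofReal_mul (by positivity), ← ofReal_norm, mul_assoc, norm_mul, hysub]
  apply ENNReal.ofReal_le_ofReal
  calc ‖b n‖ * ‖ultraFourier hs f (y (a - n)) * (ω (y a) : ℂ)‖
      ≤ C * Real.exp (-(N * ‖y n‖ ^ (1 / s))) *
          ‖ultraFourier hs f (y (a - n)) * (ω (y a) : ℂ)‖ := by
        gcongr
        exact hb n
    _ = C * (Real.exp (-(N * ‖y n‖ ^ (1 / s))) *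
          ‖ultraFourier hs f (y (a - n)) * (ω (y a) : ℂ)‖) := by ring
    _ ≤ C * _ := mul_le_mul_of_nonneg_left h1 hC
    _ = _ := by ring
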